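/- Let $G$ be a finite simple graph with vertex set $V$, and fix a total order on $V$. **Kromatic symmetric function.** $\overline X_G=\sum_\kappa\prod_{v\in V}\prod_{i\in\kappa(v)}x_i$, summed over all maps $\kappa$ that assign to each vertex a nonempty finite set of positive integers (colors) so that adjacent vertices get disjoint sets. Let $\omega$ be the involution on symmetric functions over $\mathbb Q$ with $\omega(p_\lambda)=(-1)^{|\lambda|-\ell(\lambda)}p_\lambda$, extended to infinite linear combinations $\sum_\lambda a_\lambda p_\lambda$. For $k\ge 1$ let $1+\overline p'_k=\prod_{i\ge1}\frac1{1-x_i^k}$, and for a partition $\lambda$ let $\overline p'_\lambda=\overline p'_{\lambda_1}\cdots\overline p'_{\lambda_{\ell(\lambda)}}$. **Heaps.** A heap on $G$ is a word in the alphabet $V$ up to commutation of nonadjacent letters (equivalently, an acyclic orientation of a clan graph of $G$: its vertices, called pieces, are the letters of the word, and there is an edge from each piece to every later piece at the same or an adjacent vertex). Its size is the number of pieces. Heaps are composed ($\circ$) by concatenating words. A heap is aperiodic if it is not $K^k$ for a heap $K$ and $k>1$. A pyramid is a heap with a unique source. For a piece $p$ of $H$ write $H=U\circ W$, where $W$ consists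 of the pieces reachable from $p$ by directed paths, and put $A_p(H)=W\circ U$; the rotation of a pyramid $P$ at its piece $p$ is the pyramid at which the sequence $A_p(P),A_p^2(P),\dots$ stabilizes. The standard word of a heap is its lexicographically largest word, and heaps are ordered by comparing their standard words lexicographically. A Lyndon heap is an aperiodic pyramid that is minimal among its rotations. Every heap $H$ has a unique Lyndon factorization $H=L_1\circ\dots\circ L_k$ with Lyndon heaps $L_1\ge\dots\ge L_k$. **Theorem.** The series $\omega(\overline X_G)$ has a unique expansion $\sum_\lambda c_\lambda\,\overline p'_\lambda$ (an infinite sum over all partitions $\lambda$, with $c_\lambda\in\mathbb Q$), and for every partition $\lambda$ the coefficient $c_\lambda=[\overline p'_\lambda]\,\omega(\overline X_G)$ equals the number of sets $\{L_1,\dots,L_{\ell(\lambda)}\}$ of distinct Lyndon heaps on $G$ such that each vertex of $G$ is used by at least one $L_i$ and the sizes of the $L_i$ are the parts of $\lambda$. Equivalently, $c_\lambda$ is the number of heaps on $G$ that use every vertex of $G$, whose Lyndon factors are all distinct, and whose Lyndon factors have sizes equal to the parts of $\lambda$ in some order. Both numbers are finite; in particular $c_\lambda\ge0$ for all $\lambda$,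 i.e. $\omega(\overline X_G)$ is $\overline p'$-positive. -/

import Mathlib

open scoped MvPowerSeries.WithPiTopology

namespace KromaticHeaps

/-! ### Heaps on a graph -/

section Heaps

variable {V : Type*}

/-- The defining relations for heaps: the letters `u` and `v` commute when they are not adjacent. -/
def CommRel (G : SimpleGraph V) (a b : FreeMonoid V) : Prop :=
  ∃ u v : V, ¬ G.Adj u v ∧
    a = FreeMonoid.of u * FreeMonoid.of v ∧ b = FreeMonoid.of v * FreeMonoid.of u

/-- Heaps on `G`: words in the vertices of `G`, modulo commutation of nonadjacent vertices (the
free partially commutative monoid; multiplication is the composition of heaps). The letters of a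
word are the pieces of the heap, and in the corresponding acyclic orientation of a clan graph there
is an edge from a piece to every later piece at the same or at an adjacent vertex. -/
def Heap (G : SimpleGraph V) : Type _ := PresentedMonoid (CommRel G)

instance (G : SimpleGraph V) : Monoid (Heap G) :=
  inferInstanceAs (Monoid (PresentedMonoid (CommRel G)))

variable {G : SimpleGraph V}

/-- The heap `[w]` of a word `w`. -/
def Heap.ofWord (G : SimpleGraph V) (w : List V) : Heap G :=
  PresentedMonoid.mk (CommRel G) (FreeMonoid.ofList w)

/-- The homomorphism sending a heap to the multiset of the vertices of its pieces. -/
def Heap.contentHom (G : SimpleGraph V) : Heap G →* Multiplicative (Multiset V) :=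
  PresentedMonoid.lift (fun v => Multiplicative.ofAdd ({v} : Multiset V)) (by
    rintro a b ⟨u, v, -, rfl, rfl⟩
    simp [mul_comm])

/-- The multiset of the vertices of the pieces of a heap, that is, the type of the heap. -/
def Heap.content (H : Heap G) : Multiset V := (Heap.contentHom G H).toAdd

/-- The number of pieces. -/
def Heap.size (H : Heap G) : ℕ := H.content.card

/-- The piece which is the first letter of some word of `H` is a source of the acyclic orientation,
and every source arises so. As pieces at one vertex are linearly ordered, there is at most one
source at each vertex; `H.HasSourceAt v` says that there is one at `v`. -/
def Heap.HasSourceAt (H : Heap G) (v : V) : Prop :=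
  ∃ K : Heap G, H = Heap.ofWord G [v] * K

/-- A pyramid (a heap with a unique source) whose source is a piece at the vertex `v`. -/
def Heap.IsPyramidAt (H : Heap G) (v : V) : Prop :=
  ∀ u : V, H.HasSourceAt u ↔ u = v

/-- A pyramid: a heap with a unique source. -/
def Heap.IsPyramid (H : Heap G) : Prop := ∃ v : V, H.IsPyramidAt v

/-- Aperiodic heaps: those that are not a proper power. -/
def Heap.IsAperiodic (H : Heap G) : Prop :=
  ∀ (K : Heap G) (k : ℕ), 1 < k → H ≠ K ^ k

/-- Let `p` be the piece of `H` at `v` that comes after exactly `k` other pieces at `v`.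
Then `H = U ∘ W` with `W` a pyramid whose source is `p` exactly when `W` consists of the pieces
reachable from `p` by directed paths, and `Heap.Pull v k H H'` says that `H' = A_p(H) = W ∘ U`.
The piece `p` is then the first piece at `v` in `H'`. -/
def Heap.Pull [DecidableEq V] (v : V) (k : ℕ) (H H' : Heap G) : Prop :=
  ∃ U W : Heap G, W.IsPyramidAt v ∧ U.content.count v = k ∧ H = U * W ∧ H' = W * U

/-- `Q` is the rotation of `P` for some piece `p` of `P`: the pyramid obtained by applying
`A_p` repeatedly (at least once) to `P`, always with the same piece `p`. -/
def Heap.IsRotation [DecidableEq V] (P Q : Heap G) : Prop :=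
  Q.IsPyramid ∧ ∃ (v : V) (k : ℕ) (H : Heap G),
    Heap.Pull v k P H ∧ Relation.ReflTransGen (Heap.Pull v 0) H Q

theorem Heap.content_ofWord (w : List V) : (Heap.ofWord G w).content = (w : Multiset V) := by
  induction w with
  | nil => rfl
  | cons a w ih =>
    have h : Heap.ofWord G (a :: w) = Heap.ofWord G [a] * Heap.ofWord G w := rfl
    have h1 : (Heap.ofWord G [a]).content = {a} := rfl
    have h2 : (Heap.ofWord G [a] * Heap.ofWord G w).content
        = (Heap.ofWord G [a]).content + (Heap.ofWord G w).content := by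
      simp [Heap.content]
    rw [h, h2, h1, ih]
    rfl

/-- Every heap has a lexicographically largest word. -/
theorem Heap.exists_isGreatest_word [LinearOrder V] (H : Heap G) :
    ∃ w : List V, IsGreatest {w : List V | Heap.ofWord G w = H} w := by
  obtain ⟨w₀, hw₀⟩ := PresentedMonoid.surjective_mk (rels := CommRel G) H
  have hw : Heap.ofWord G (FreeMonoid.toList w₀) = H := hw₀
  have hfin : {w : List V | Heap.ofWord G w = H}.Finite := by
    refine ((FreeMonoid.toList w₀).permutations.toFinset.finite_toSet).subset ?_
    intro w h
    have h' : Heap.ofWord G w = Heap.ofWord G (FreeMonoid.toList w₀) := h.trans hw.symm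
    have h2 := congrArg Heap.content h'
    rw [Heap.content_ofWord, Heap.content_ofWord, Multiset.coe_eq_coe] at h2
    simpa using h2
  obtain ⟨w, hmem, hmax⟩ := Set.exists_max_image _ id hfin ⟨_, hw⟩
  exact ⟨w, hmem, fun x hx => hmax x hx⟩

/-- The standard word `St(H)`: the lexicographically largest word of `H`. Heaps are compared
through the lexicographic order of their standard words. -/
noncomputable def Heap.std [LinearOrder V] (H : Heap G) : List V :=
  H.exists_isGreatest_word.choose

/-- Lyndon heaps: the aperiodic pyramids that are minimal among their rotations. -/
def Heap.IsLyndon [LinearOrder V] (L : Heap G) : Prop :=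
  L.IsPyramid ∧ L.IsAperiodic ∧ ∀ Q : Heap G, L.IsRotation Q → L.std ≤ Q.std

/-- `l = [L₁, …, L_k]` is a Lyndon factorization of `H`: `H = L₁ ∘ … ∘ L_k` with Lyndon heaps
`L₁ ≥ … ≥ L_k`. -/
def Heap.IsLyndonFactorization [LinearOrder V] (H : Heap G) (l : List (Heap G)) : Prop :=
  (∀ L ∈ l, L.IsLyndon) ∧ l.Pairwise (fun A B => B.std ≤ A.std) ∧ l.prod = H

end Heaps

/-! ### Symmetric functions

Power series in the variables `X 0, X 1, …` with rational coefficients; infinite sums and products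
are taken coefficientwise. -/

section Symmetric

/-- Partitions of all natural numbers. -/
abbrev Ptn : Type := Σ n : ℕ, n.Partition

/-- The family `b_λ = b_{λ₁} b_{λ₂} ⋯` associated to a sequence `b_k`. -/
noncomputable def multiplicative (b : ℕ → MvPowerSeries ℕ ℚ) (l : Ptn) : MvPowerSeries ℕ ℚ :=
  (l.2.parts.map b).prod

/-- The power sum `p_k = x_1^k + x_2^k + ⋯`. -/
noncomputable def powerSum (k : ℕ) : MvPowerSeries ℕ ℚ :=
  ∑' i : ℕ, (MvPowerSeries.X i : MvPowerSeries ℕ ℚ) ^ k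

/-- The series `p̄'_k`, defined by `1 + p̄'_k = ∏ i, 1 / (1 - x_i ^ k)`. -/
noncomputable def pbar' (k : ℕ) : MvPowerSeries ℕ ℚ :=
  (∏' i : ℕ, (1 - (MvPowerSeries.X i : MvPowerSeries ℕ ℚ) ^ k)⁻¹) - 1

/-- `f = ∑ λ, c_λ b_λ`. -/
def HasExpansion (b : Ptn → MvPowerSeries ℕ ℚ) (c : Ptn → ℚ) (f : MvPowerSeries ℕ ℚ) : Prop :=
  HasSum (fun l : Ptn => c l • b l) f

/-- `g = ω(f)`, where `ω` is the involution with `ω(p_λ) = (-1)^(|λ| - ℓ(λ)) p_λ`, extended to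
symmetric series of unbounded degree by infinite linear combinations. -/
def IsOmega (f g : MvPowerSeries ℕ ℚ) : Prop :=
  ∃ a : Ptn → ℚ, HasExpansion (multiplicative powerSum) a f ∧
    HasExpansion (multiplicative powerSum)
      (fun l => (-1) ^ (l.1 - l.2.parts.card) * a l) g

/-- Proper set colorings: each vertex gets a nonempty set of colors, and adjacent vertices get
disjoint sets. Infinite color sets are left out, as they do not give a monomial. -/
def IsProperSetColoring {V : Type*} (G : SimpleGraph V) (κ : V → Finset ℕ) : Prop :=
  (∀ v, (κ v).Nonempty) ∧ ∀ u v, G.Adj u v → Disjoint (κ u) (κ v)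

/-- The Kromatic symmetric function of `G`. -/
noncomputable def kromatic {V : Type*} [Fintype V] (G : SimpleGraph V) : MvPowerSeries ℕ ℚ :=
  ∑' κ : {κ : V → Finset ℕ // IsProperSetColoring G κ},
    ∏ v : V, ∏ i ∈ κ.1 v, (MvPowerSeries.X i : MvPowerSeries ℕ ℚ)

/-! The sums and products above converge. -/

theorem summable_powerSum {k : ℕ} (hk : k ≠ 0) :
    Summable (fun i : ℕ => (MvPowerSeries.X i : MvPowerSeries ℕ ℚ) ^ k) := by
  rw [MvPowerSeries.WithPiTopology.summable_iff_summable_coeff]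
  intro d
  refine summable_of_hasFiniteSupport ((d.support.finite_toSet).subset ?_)
  intro i hi
  simp only [Function.mem_support, MvPowerSeries.coeff_X_pow, ne_eq, ite_eq_right_iff,
    one_ne_zero, imp_false, not_not] at hi
  simp [hi, hk]

theorem multipliable_pbar' {k : ℕ} (hk : k ≠ 0) :
    Multipliable (fun i : ℕ => (1 - (MvPowerSeries.X i : MvPowerSeries ℕ ℚ) ^ k)⁻¹) := by
  have key : ∀ i : ℕ, (1 - (MvPowerSeries.X i : MvPowerSeries ℕ ℚ) ^ k)⁻¹
      = 1 + MvPowerSeries.X i ^ k * (1 - (MvPowerSeries.X i : MvPowerSeries ℕ ℚ) ^ k)⁻¹ := by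
    intro i
    have h := MvPowerSeries.mul_inv_cancel (1 - (MvPowerSeries.X i : MvPowerSeries ℕ ℚ) ^ k)
      (by simp [hk])
    linear_combination h
  rw [funext key]
  refine MvPowerSeries.WithPiTopology.multipliable_one_add_of_tendsto_weightedOrder_atTop_nhds_top
    (w := fun i : ℕ => i) ?_
  rw [ENat.tendsto_nhds_top_iff_natCast_lt]
  intro n
  filter_upwards [Filter.eventually_gt_atTop n] with i hi
  refine lt_of_lt_of_le (?_ : (n : ℕ∞) < (i : ℕ∞)) ?_
  · exact_mod_cast hi
  · refine le_trans ?_ (MvPowerSeries.le_weightedOrder_mul _)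
    refine le_trans ?_ le_self_add
    rw [MvPowerSeries.X_pow_eq, MvPowerSeries.weightedOrder_monomial_of_ne_zero _ one_ne_zero]
    rw [Finsupp.weight_single]
    have : i ≤ k * i := Nat.le_mul_of_pos_left _ (Nat.pos_of_ne_zero hk)
    exact_mod_cast this

theorem summable_kromatic {V : Type*} [Fintype V] (G : SimpleGraph V) :
    Summable (fun κ : {κ : V → Finset ℕ // IsProperSetColoring G κ} =>
      ∏ v : V, ∏ i ∈ κ.1 v, (MvPowerSeries.X i : MvPowerSeries ℕ ℚ)) := by
  classical
  have hmon : ∀ κ : V → Finset ℕ,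
      ∏ v : V, ∏ i ∈ κ v, (MvPowerSeries.X i : MvPowerSeries ℕ ℚ)
        = MvPowerSeries.monomial (∑ v : V, ∑ i ∈ κ v, Finsupp.single i 1) 1 := by
    intro κ
    have h : ∏ v : V, ∏ i ∈ κ v, (MvPolynomial.X i : MvPolynomial ℕ ℚ)
        = MvPolynomial.monomial (∑ v : V, ∑ i ∈ κ v, Finsupp.single i 1) 1 := by
      simp_rw [MvPolynomial.monomial_sum_one]
      rfl
    have h2 := congrArg (MvPolynomial.coeToMvPowerSeries.ringHom (R := ℚ) (σ := ℕ)) h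
    simpa [map_prod] using h2
  rw [MvPowerSeries.WithPiTopology.summable_iff_summable_coeff]
  intro d
  refine summable_of_hasFiniteSupport ?_
  have hfin : (Set.univ.pi fun _ : V => (d.support.powerset : Set (Finset ℕ))).Finite :=
    Set.Finite.pi fun _ => Finset.finite_toSet _
  refine (hfin.preimage Subtype.val_injective.injOn).subset ?_
  rintro ⟨κ, hκ⟩ h
  simp only [Function.mem_support, hmon, MvPowerSeries.coeff_monomial, ne_eq,
    ite_eq_right_iff, one_ne_zero, imp_false, not_not] at h
  simp only [Set.mem_preimage, Set.mem_pi, Set.mem_univ, forall_const, Finset.mem_coe,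
    Finset.mem_powerset]
  intro v i hi
  rw [h, Finsupp.mem_support_iff, Finsupp.finsetSum_apply]
  refine ne_of_gt (lt_of_lt_of_le Nat.one_pos ?_)
  refine le_trans ?_ (Finset.single_le_sum (fun _ _ => Nat.zero_le _) (Finset.mem_univ v))
  rw [Finsupp.finsetSum_apply]
  refine le_trans ?_ (Finset.single_le_sum (fun _ _ => Nat.zero_le _) hi)
  simp

end Symmetric

end KromaticHeaps

namespace KromaticHeaps

/-! ### Lyndon words -/

section LyndonWords

variable {V : Type*} [LinearOrder V]

/-! The coefficient of `x^d` in the Kromatic function counts families of stable sets, one of size `d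
i` for each variable `i` of the monomial, that together cover `V` (the color classes;
`coeff_kromatic`). Inclusion-exclusion over the allowed vertex set `W` turns this into a signed sum
of products `∏ i, g_W (x_i)`, where `g_W(t)` counts the stable sets inside `W` by size.

By the Cartier–Foata identity (`sum_antidiagonal_stable_heap`), `g_W(-t) h_W(t) = 1`, where `h_W(t)`
counts the heaps with pieces in `W`. Taking logarithmic derivatives, `ω` sends `∏ g_W(x_i)` to `∏
h_W(x_i)` (`mulSeries_mem_omegaSpan_of_inverse`). Undoing the inclusion-exclusion, the coefficient
of `x^d` in the image counts covering families of heaps of sizes `d i` (`coeff_omegaKromatic`).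

Unique Lyndon factorization identifies a heap with a multiset of Lyndon heaps. Sort the families by
the set `S` of Lyndon heaps that occur in them. For fixed `S`, each `L ∈ S` independently receives a
multiplicity for every variable, not all zero, which gives the factor `∏ i, 1 / (1 - x_i ^ |L|) - 1
= p̄'_{|L|}` (`coeff_prod_pbar'`). Whether a family covers `V` depends only on `S`, so summing over
the covering sets `S` gives the expansion. It is unique because the `p̄'_λ`, like the `p_λ`, are
triangular with respect to monomials (`PowerSumLike`).

Lyndon factorization of heaps is reduced to words: a heap is Lyndon iff its standard word is a
Lyndon word (`isLyndon_iff`), factors of standard words are standard, and a weakly decreasing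
product of standard Lyndon words is standard (`isStd_flatten_std`). -/

theorem lex_append_left_iff (s a b : List V) : s ++ a < s ++ b ↔ a < b := by
  induction s with
  | nil => rfl
  | cons c s ih => simpa [List.cons_lt_cons_iff] using ih

theorem lex_le_of_prefix {x y : List V} (h : x <+: y) : x ≤ y := by
  obtain ⟨z, rfl⟩ := h
  rw [← not_lt]
  intro hlt
  have : x ++ z < x ++ [] := by simpa using hlt
  rw [lex_append_left_iff] at this
  exact List.not_lt_nil _ this

theorem lex_append_of_not_prefix {x y : List V} (h : x < y) (hp : ¬ x <+: y) (u v : List V) :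
    x ++ u < y ++ v := by
  induction x generalizing y with
  | nil => exact absurd (List.nil_prefix) hp
  | cons a x ih =>
    cases y with
    | nil => exact absurd h (List.not_lt_nil _)
    | cons b y =>
      rw [List.cons_lt_cons_iff] at h
      rw [List.cons_append, List.cons_append, List.cons_lt_cons_iff]
      rcases h with h | ⟨rfl, h⟩
      · exact Or.inl h
      · exact Or.inr ⟨rfl, ih h fun hp' => hp (by simpa using hp')⟩

theorem not_prefix_of_length_le {α : Type*} {x y : List α} (h : x ≠ y) (hl : y.length ≤ x.length) :
    ¬ x <+: y := fun hp => h (hp.eq_of_length (le_antisymm hp.length_le hl))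

theorem lex_append_of_length_le {x y : List V} (h : x < y) (hl : y.length ≤ x.length)
    (u v : List V) : x ++ u < y ++ v :=
  lex_append_of_not_prefix h (not_prefix_of_length_le h.ne hl) u v

theorem lex_append_le_of_length_eq {x y u v : List V} (hl : x.length = y.length)
    (h : x ++ u ≤ y ++ v) : x ≤ y := by
  by_contra hlt
  exact absurd h (lex_append_of_length_le (not_le.1 hlt) hl.le v u).not_ge

/-- Lyndon words: the words that are strictly smaller than all their proper rotations. -/
def IsLyndonWord (w : List V) : Prop :=
  w ≠ [] ∧ ∀ u v : List V, u ≠ [] → v ≠ [] → w = u ++ v → w < v ++ u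

/-- Suppose `v < w`. If `v` is not a prefix of `w`, the comparison survives appending `u` and
contradicts `w < v ++ u`. If `w = v ++ z`, then `w < v ++ u` gives `z < u`, so the rotation `z ++ v`
is smaller than `u ++ v = w`. -/
theorem IsLyndonWord.lt_suffix {w u v : List V} (h : IsLyndonWord w) (hu : u ≠ []) (hv : v ≠ [])
    (hw : w = u ++ v) : w < v := by
  by_contra hlt
  have hne : v ≠ w := by
    rintro rfl
    exact hu (by simpa using hw)
  have hlt' : v < w := lt_of_le_of_ne (not_lt.1 hlt) hne
  have hrot := h.2 u v hu hv hw
  by_cases hp : v <+: w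
  · obtain ⟨z, rfl⟩ := hp
    rw [lex_append_left_iff] at hrot
    have hlen : z.length = u.length := by
      have := congrArg List.length hw
      simp only [List.length_append] at this
      omega
    have hz : z ≠ [] := by
      rintro rfl
      exact hu (List.length_eq_zero_iff.1 hlen.symm)
    have h1 := h.2 v z hv hz rfl
    have h2 := lex_append_of_length_le hrot hlen.ge v v
    rw [← hw] at h2
    exact lt_asymm h1 h2
  · have := lex_append_of_not_prefix hlt' hp u []
    rw [List.append_nil] at this
    exact lt_asymm this hrot

theorem isLyndonWord_of_lt_suffix {w : List V} (hw : w ≠ [])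
    (h : ∀ u v : List V, u ≠ [] → v ≠ [] → w = u ++ v → w < v) : IsLyndonWord w := by
  refine ⟨hw, fun u v hu hv huv => ?_⟩
  have h1 := h u v hu hv huv
  have := lex_append_of_length_le h1 (by rw [huv]; simp) [] u
  simpa using this

theorem isLyndonWord_singleton (a : V) : IsLyndonWord [a] := by
  refine isLyndonWord_of_lt_suffix (by simp) fun u v hu hv h => ?_
  have := congrArg List.length h
  have := List.length_pos_iff.2 hu
  have := List.length_pos_iff.2 hv
  simp only [List.length_append, List.length_singleton] at *
  omega

theorem IsLyndonWord.head_le {a : V} {w : List V} (h : IsLyndonWord (a :: w)) :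
    ∀ b ∈ a :: w, a ≤ b := by
  intro b hb
  rcases List.mem_cons.1 hb with rfl | hb
  · exact le_rfl
  · obtain ⟨s, t, rfl⟩ := List.append_of_mem hb
    have := h.lt_suffix (u := a :: s) (v := b :: t) (by simp) (by simp) (by simp)
    rw [List.cons_lt_cons_iff] at this
    rcases this with h | ⟨h, -⟩
    · exact h.le
    · exact h.le

/-- The crux is `x ++ y < y`. Every other proper suffix is a suffix of `y`, or is `s ++ y` with `s`
a proper suffix of `x`, and then `x < s` decides. -/
theorem IsLyndonWord.append {x y : List V} (hx : IsLyndonWord x) (hy : IsLyndonWord y)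
    (hxy : x < y) : IsLyndonWord (x ++ y) := by
  have hlt : x ++ y < y := by
    by_cases hp : x <+: y
    · obtain ⟨z, rfl⟩ := hp
      have hz : z ≠ [] := by
        rintro rfl
        simp at hxy
      rw [lex_append_left_iff]
      exact hy.lt_suffix hx.1 hz rfl
    · simpa using lex_append_of_not_prefix hxy hp y []
  refine isLyndonWord_of_lt_suffix (by simp [hx.1]) fun u v hu hv h => ?_
  rcases List.append_eq_append_iff.1 h with ⟨s, rfl, hs⟩ | ⟨s, rfl, rfl⟩
  · rcases eq_or_ne s [] with rfl | hs'
    · simpa [hs] using hlt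
    · exact hlt.trans (hy.lt_suffix hs' hv hs)
  · rcases eq_or_ne s [] with rfl | hs'
    · simpa using hlt
    · have h1 := hx.lt_suffix hu hs' rfl
      exact lex_append_of_length_le h1 (by simp) y y

/-- A new first factor `x` that is smaller than its successor `z` is merged with it, since `x ++ z`
is again Lyndon; this repeats until the order is right. -/
theorem exists_lyndonWord_factorization_cons (l : List (List V)) :
    ∀ x : List V, IsLyndonWord x → (∀ y ∈ l, IsLyndonWord y) → l.Pairwise (fun a b => b ≤ a) →
    ∃ l' : List (List V), (∀ y ∈ l', IsLyndonWord y) ∧ l'.Pairwise (fun a b => b ≤ a) ∧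
      l'.flatten = x ++ l.flatten := by
  induction l with
  | nil => exact fun x hx _ _ => ⟨[x], by simpa using hx, by simp, by simp⟩
  | cons z l ih =>
    intro x hx hl hp
    rw [List.pairwise_cons] at hp
    by_cases hzx : z ≤ x
    · refine ⟨x :: z :: l, ?_, ?_, by simp⟩
      · simpa using ⟨hx, by simpa using hl⟩
      · simp only [List.pairwise_cons, List.mem_cons]
        refine ⟨?_, hp⟩
        rintro b (rfl | hb)
        · exact hzx
        · exact (hp.1 b hb).trans hzx
    · obtain ⟨l', h1, h2, h3⟩ := ih (x ++ z) (hx.append (hl z (by simp)) (not_le.1 hzx))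
        (fun y hy => hl y (by simp [hy])) hp.2
      exact ⟨l', h1, h2, by simp [h3]⟩

theorem exists_lyndonWord_factorization (w : List V) :
    ∃ l : List (List V), (∀ y ∈ l, IsLyndonWord y) ∧ l.Pairwise (fun a b => b ≤ a) ∧
      l.flatten = w := by
  induction w with
  | nil => exact ⟨[], by simp, by simp, by simp⟩
  | cons a w ih =>
    obtain ⟨l, h1, h2, h3⟩ := ih
    obtain ⟨l', h1', h2', h3'⟩ :=
      exists_lyndonWord_factorization_cons l [a] (isLyndonWord_singleton a) h1 h2
    exact ⟨l', h1', h2', by simp [h3', h3]⟩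

/-- The prefix `p` ends inside some factor. The part of `p` in that factor is a prefix of it, hence
at most that factor. -/
theorem exists_suffix_le_of_prefix_flatten {b : List V} (l : List (List V)) :
    ∀ p : List V, p ≠ [] → (∀ y ∈ l, y ≤ b) → p <+: l.flatten →
      ∃ s, s ≠ [] ∧ s <:+ p ∧ s ≤ b := by
  induction l with
  | nil =>
    intro p hp _ h
    exact absurd (by simpa using h) hp
  | cons z l ih =>
    intro p hp hl h
    have h : p <+: z ∨ ∃ t, p = z ++ t ∧ t <+: l.flatten := by
      rw [List.flatten_cons] at h
      rcases le_total p.length z.length with hl | hl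
      · exact Or.inl (List.prefix_of_prefix_length_le h (List.prefix_append _ _) hl)
      · obtain ⟨t, rfl⟩ := List.prefix_of_prefix_length_le (List.prefix_append _ _) h hl
        exact Or.inr ⟨t, rfl, by simpa using h⟩
    have key : p <+: z → ∃ s, s ≠ [] ∧ s <:+ p ∧ s ≤ b := fun h =>
      ⟨p, hp, List.suffix_rfl, (lex_le_of_prefix h).trans (hl z (by simp))⟩
    rcases h with h | ⟨t, rfl, ht⟩
    · exact key h
    · rcases eq_or_ne t [] with rfl | htne
      · exact key (by simp)
      · obtain ⟨s, h1, h2, h3⟩ := ih t htne (fun y hy => hl y (by simp [hy])) ht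
        exact ⟨s, h1, h2.trans (List.suffix_append _ _), h3⟩

/-- If `y = x ++ p` with `p` nonempty, then `p` has a suffix `s ≤ x ≤ y`. This `s` is also a proper
suffix of the Lyndon word `y`, which must exceed `y`. -/
theorem not_length_lt_of_lyndonWord_flatten {x y : List V} {l l' : List (List V)}
    (hy : IsLyndonWord y) (hx : x ≠ []) (hl : ∀ z ∈ l, z ≤ x)
    (h : (x :: l).flatten = (y :: l').flatten) : ¬ x.length < y.length := by
  intro hlen
  simp only [List.flatten_cons] at h
  rcases List.append_eq_append_iff.1 h with ⟨p, rfl, hp⟩ | ⟨p, rfl, -⟩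
  · have hpne : p ≠ [] := by
      rintro rfl
      simp at hlen
    obtain ⟨s, hs, ⟨t, rfl⟩, hsb⟩ :=
      exists_suffix_le_of_prefix_flatten l p hpne hl ⟨_, hp.symm⟩
    have h1 := hy.lt_suffix (u := x ++ t) (v := s) (by simp [hx]) hs (by simp)
    have h2 : x ≤ x ++ (t ++ s) := lex_le_of_prefix ⟨_, rfl⟩
    exact absurd (hsb.trans h2) h1.not_ge
  · simp at hlen

theorem lyndonWord_factorization_unique (l : List (List V)) :
    ∀ l' : List (List V), (∀ y ∈ l, IsLyndonWord y) → l.Pairwise (fun a b => b ≤ a) →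
      (∀ y ∈ l', IsLyndonWord y) → l'.Pairwise (fun a b => b ≤ a) → l.flatten = l'.flatten →
      l = l' := by
  induction l with
  | nil =>
    intro l' _ _ h _ he
    cases l' with
    | nil => rfl
    | cons y l' => exact absurd (by simpa using he.symm) (fun hh : y = [] ∧ _ => (h y (by simp)).1 hh.1)
  | cons x l ih =>
    intro l' h hp h' hp' he
    cases l' with
    | nil => exact absurd (by simpa using he) (fun hh : x = [] ∧ _ => (h x (by simp)).1 hh.1)
    | cons y l' =>
      rw [List.pairwise_cons] at hp hp'
      have hx := h x (by simp)
      have hy := h' y (by simp)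
      have h1 := not_length_lt_of_lyndonWord_flatten hy hx.1 hp.1 he
      have h2 := not_length_lt_of_lyndonWord_flatten hx hy.1 hp'.1 he.symm
      simp only [List.flatten_cons] at he
      obtain ⟨he1, he2⟩ := List.append_inj he (by omega)
      rw [he1, ih l' (fun z hz => h z (by simp [hz])) hp.2 (fun z hz => h' z (by simp [hz]))
        hp'.2 he2]

/-- Commuting words are powers of a common word, by the Euclidean algorithm on lengths; `n` only
bounds the induction. -/
theorem exists_power_of_append_comm {α : Type*} (n : ℕ) : ∀ u w : List α, u.length + w.length ≤ n →
    u ++ w = w ++ u → ∃ (z : List α) (i j : ℕ),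
      u = (List.replicate i z).flatten ∧ w = (List.replicate j z).flatten := by
  induction n with
  | zero =>
    intro u w h _
    refine ⟨[], 0, 0, ?_, ?_⟩ <;> simp only [List.replicate_zero, List.flatten_nil] <;>
      apply List.length_eq_zero_iff.1 <;> omega
  | succ n ih =>
    intro u w h he
    rcases eq_or_ne u [] with rfl | hu
    · exact ⟨w, 0, 1, by simp, by simp⟩
    rcases eq_or_ne w [] with rfl | hw
    · exact ⟨u, 1, 0, by simp, by simp⟩
    have hu' := List.length_pos_iff.2 hu
    have hw' := List.length_pos_iff.2 hw
    rcases List.append_eq_append_iff.1 he with ⟨s, rfl, hs⟩ | ⟨s, rfl, hs⟩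
    · obtain ⟨z, i, j, h1, h2⟩ := ih u s (by simp at h; omega) hs
      refine ⟨z, i, i + j, h1, ?_⟩
      rw [List.replicate_add, List.flatten_append, ← h1, ← h2]
    · obtain ⟨z, i, j, h1, h2⟩ := ih s w (by simp at h; omega) hs.symm
      refine ⟨z, j + i, j, ?_, h2⟩
      rw [List.replicate_add, List.flatten_append, ← h1, ← h2]

end LyndonWords

/-! ### Sources of heaps -/

section HeapSources

variable {V : Type*} {G : SimpleGraph V}

namespace Heap

@[simp] theorem ofWord_nil : ofWord G ([] : List V) = 1 := rfl

theorem ofWord_append (x y : List V) : ofWord G (x ++ y) = ofWord G x * ofWord G y := rfl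

theorem ofWord_cons (a : V) (x : List V) : ofWord G (a :: x) = ofWord G [a] * ofWord G x := rfl

theorem ofWord_surjective (H : Heap G) : ∃ w, ofWord G w = H := by
  obtain ⟨w, hw⟩ := PresentedMonoid.surjective_mk (rels := CommRel G) H
  exact ⟨w, hw⟩

theorem ofWord_flatten (l : List (List V)) :
    ofWord G l.flatten = (l.map (ofWord G)).prod := by
  induction l with
  | nil => rfl
  | cons x l ih => rw [List.flatten_cons, ofWord_append, ih, List.map_cons, List.prod_cons]

theorem ofWord_swap {a b : V} (h : ¬ G.Adj a b) :
    ofWord G [a] * ofWord G [b] = ofWord G [b] * ofWord G [a] :=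
  PresentedMonoid.mk_eq_mk_of_rel ⟨a, b, h, rfl, rfl⟩

theorem ofWord_comm {a : V} {x : List V} (h : ∀ b ∈ x, ¬ G.Adj a b) :
    ofWord G [a] * ofWord G x = ofWord G x * ofWord G [a] := by
  induction x with
  | nil => simp
  | cons b x ih =>
    rw [ofWord_cons b x, ← mul_assoc, ofWord_swap (h b (by simp)), mul_assoc,
      ih fun c hc => h c (by simp [hc]), mul_assoc]

@[simp] theorem content_one : (1 : Heap G).content = 0 := rfl

@[simp] theorem content_mul (A B : Heap G) : (A * B).content = A.content + B.content := by
  simp [content]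

@[simp] theorem size_one : (1 : Heap G).size = 0 := rfl

@[simp] theorem size_mul (A B : Heap G) : (A * B).size = A.size + B.size := by
  simp [size]

theorem size_ofWord (w : List V) : (ofWord G w).size = w.length := by
  simp [size, content_ofWord]

theorem length_eq_of_ofWord_eq {x y : List V} (h : ofWord G x = ofWord G y) :
    x.length = y.length := by
  simpa [size_ofWord] using congrArg size h

theorem content_list_prod (f : List (Heap G)) : f.prod.content = (f.map content).sum := by
  induction f with
  | nil => rfl
  | cons L f ih => simp [ih]

theorem mem_content_ofWord {w : List V} {v : V} : v ∈ (ofWord G w).content ↔ v ∈ w := by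
  simp [content_ofWord]

theorem eq_one_of_size_eq_zero {H : Heap G} (h : H.size = 0) : H = 1 := by
  obtain ⟨w, rfl⟩ := H.ofWord_surjective
  rw [size_ofWord, List.length_eq_zero_iff] at h
  rw [h, ofWord_nil]

theorem size_eq_zero_iff {H : Heap G} : H.size = 0 ↔ H = 1 :=
  ⟨eq_one_of_size_eq_zero, fun h => by rw [h, size_one]⟩

theorem comm_of_not_adj {a : V} {A : Heap G} (h : ∀ b ∈ A.content, ¬ G.Adj a b) :
    ofWord G [a] * A = A * ofWord G [a] := by
  obtain ⟨w, rfl⟩ := A.ofWord_surjective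
  exact ofWord_comm fun b hb => h b (mem_content_ofWord.2 hb)

open Classical in
/-- Left multiplication by a letter, together with the removal of the source at `u`. -/
noncomputable def stripStep (G : SimpleGraph V) (u a : V) :
    Function.End (Heap G × Option (Heap G)) :=
  fun p => (ofWord G [a] * p.1,
    if a = u then some p.1 else if G.Adj a u then none else p.2.map (ofWord G [a] * ·))

/-- This commutation lets `PresentedMonoid.lift` define the removal of a source on heaps rather than
on words; left cancellation and the description of sources of products rest on it. The state carries
the heap itself because, on reading the letter `u`, the stripped heap is the heap built so far. -/
theorem stripStep_comm {u a b : V} (hab : ¬ G.Adj a b) :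
    stripStep G u a * stripStep G u b = stripStep G u b * stripStep G u a := by
  have hs := ofWord_swap hab
  have hba : ¬ G.Adj b a := fun h => hab h.symm
  funext p
  change stripStep G u a (stripStep G u b p) = stripStep G u b (stripStep G u a p)
  refine Prod.ext ?_ ?_
  · simp only [stripStep, ← mul_assoc, hs]
  · by_cases ha : a = u
    · subst ha
      by_cases hb : b = a
      · subst hb; rfl
      · simp [stripStep, hb, hba]
    · by_cases hb : b = u
      · subst hb
        simp [stripStep, ha, hab]
      · by_cases ha' : G.Adj a u <;> by_cases hb' : G.Adj b u <;>
          simp [stripStep, ha, hb, ha', hb']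
        congr 1
        funext x
        simp only [hs]

/-- Left multiplication, together with the removal of the source at `u` (if there is one). -/
noncomputable def stripHom (G : SimpleGraph V) (u : V) :
    Heap G →* Function.End (Heap G × Option (Heap G)) :=
  PresentedMonoid.lift (stripStep G u) (by
    rintro _ _ ⟨a, b, hab, rfl, rfl⟩
    simpa using stripStep_comm hab)

theorem stripHom_cons (u a : V) (H : Heap G) (p : Heap G × Option (Heap G)) :
    stripHom G u (ofWord G [a] * H) p = stripStep G u a (stripHom G u H p) := by
  rw [map_mul]
  rfl

/-- The heap with its source at `u` removed, if there is a source at `u`. -/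
noncomputable def strip (u : V) (H : Heap G) : Option (Heap G) := (stripHom G u H (1, none)).2

theorem stripHom_fst (u : V) (H : Heap G) (p : Heap G × Option (Heap G)) :
    (stripHom G u H p).1 = H * p.1 := by
  obtain ⟨w, rfl⟩ := H.ofWord_surjective
  induction w with
  | nil => exact (one_mul p.1).symm
  | cons a w ih =>
    rw [ofWord_cons, stripHom_cons, mul_assoc, ← ih]
    rfl

open Classical in
theorem strip_cons (u a : V) (H : Heap G) : strip u (ofWord G [a] * H) =
    if a = u then some H else if G.Adj a u then none else
      (strip u H).map (ofWord G [a] * ·) := by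
  have h : strip u (ofWord G [a] * H) = if a = u then some (stripHom G u H (1, none)).1 else
      if G.Adj a u then none else (strip u H).map (ofWord G [a] * ·) := by
    rw [strip, stripHom_cons]
    rfl
  rw [h, stripHom_fst, mul_one]

theorem strip_self (u : V) (H : Heap G) : strip u (ofWord G [u] * H) = some H := by
  simp [strip_cons]

theorem cons_left_cancel {a : V} {A B : Heap G} (h : ofWord G [a] * A = ofWord G [a] * B) :
    A = B := by
  have := congrArg (strip a) h
  simpa [strip_self] using this

/-- A source of a product is a source of the left factor, or a source of the right factor that is
independent of the left factor. -/
theorem HasSourceAt.of_mul {u : V} {A B : Heap G} (h : (A * B).HasSourceAt u) :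
    A.HasSourceAt u ∨ u ∉ A.content ∧ (∀ b ∈ A.content, ¬ G.Adj b u) ∧ B.HasSourceAt u := by
  classical
  obtain ⟨w, rfl⟩ := A.ofWord_surjective
  induction w with
  | nil => exact Or.inr (by simpa using h)
  | cons a w ih =>
    obtain ⟨K, hK⟩ := h
    have hs := congrArg (strip u) hK
    rw [strip_self, ofWord_cons, mul_assoc, strip_cons] at hs
    by_cases ha : a = u
    · subst ha
      exact Or.inl ⟨_, ofWord_cons _ _⟩
    · by_cases hadj : G.Adj a u
      · simp [ha, hadj] at hs
      · simp only [ha, hadj, if_false, Option.map_eq_some_iff] at hs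
        obtain ⟨K', -, rfl⟩ := hs
        have hua : ¬ G.Adj u a := fun h => hadj h.symm
        have h2 : (ofWord G w * B).HasSourceAt u := by
          refine ⟨K', cons_left_cancel (a := a) ?_⟩
          rw [← mul_assoc, ← ofWord_cons, hK, ← mul_assoc, ← mul_assoc, ofWord_swap hua]
        rcases ih h2 with ⟨K'', hK''⟩ | ⟨h3, h4, h5⟩
        · refine Or.inl ⟨ofWord G [a] * K'', ?_⟩
          rw [ofWord_cons, hK'', ← mul_assoc, ← mul_assoc, ofWord_swap hua]
        · right
          rw [mem_content_ofWord] at h3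
          refine ⟨?_, ?_, h5⟩
          · rw [mem_content_ofWord]
            simp [h3, Ne.symm ha]
          · intro b hb
            rw [mem_content_ofWord, List.mem_cons] at hb
            rcases hb with rfl | hb
            · exact hadj
            · exact h4 b (mem_content_ofWord.2 hb)

theorem HasSourceAt.mul_right {u : V} {A : Heap G} (h : A.HasSourceAt u) (B : Heap G) :
    (A * B).HasSourceAt u := by
  obtain ⟨K, rfl⟩ := h
  exact ⟨K * B, mul_assoc _ _ _⟩

theorem HasSourceAt.mul_left {u : V} {A B : Heap G} (h : ∀ b ∈ A.content, ¬ G.Adj u b)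
    (hB : B.HasSourceAt u) : (A * B).HasSourceAt u := by
  obtain ⟨K, rfl⟩ := hB
  exact ⟨A * K, by rw [← mul_assoc, ← mul_assoc, comm_of_not_adj h]⟩

theorem HasSourceAt.mem_content {u : V} {A : Heap G} (h : A.HasSourceAt u) : u ∈ A.content := by
  obtain ⟨K, rfl⟩ := h
  simp [content_ofWord]

theorem not_hasSourceAt_one (u : V) : ¬ (1 : Heap G).HasSourceAt u := fun h => by
  simpa using h.mem_content

theorem hasSourceAt_cons (a : V) (w : List V) : (ofWord G (a :: w)).HasSourceAt a :=
  ⟨_, ofWord_cons _ _⟩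

theorem hasSourceAt_singleton {u a : V} : (ofWord G [a]).HasSourceAt u ↔ u = a := by
  refine ⟨fun h => ?_, fun h => h ▸ hasSourceAt_cons _ _⟩
  simpa [content_ofWord] using h.mem_content

/-- A source of a word occurs as a letter that is independent of all earlier letters. -/
theorem HasSourceAt.exists_eq_append {u : V} {w : List V} (h : (ofWord G w).HasSourceAt u) :
    ∃ x y, w = x ++ u :: y ∧ u ∉ x ∧ ∀ b ∈ x, ¬ G.Adj b u := by
  induction w with
  | nil => exact absurd h (not_hasSourceAt_one u)
  | cons a w ih =>
    by_cases ha : a = u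
    · exact ⟨[], w, by simp [ha], by simp, by simp⟩
    · rw [ofWord_cons] at h
      rcases h.of_mul with h | ⟨h1, h2, h3⟩
      · exact absurd (hasSourceAt_singleton.1 h).symm ha
      · obtain ⟨x, y, rfl, h4, h5⟩ := ih h3
        refine ⟨a :: x, y, by simp, by simp [h4, Ne.symm ha], ?_⟩
        intro b hb
        rcases List.mem_cons.1 hb with rfl | hb
        · exact h2 b (by simp [content_ofWord])
        · exact h5 b hb

theorem exists_hasSourceAt {H : Heap G} (h : H ≠ 1) : ∃ u, H.HasSourceAt u := by
  obtain ⟨w, rfl⟩ := H.ofWord_surjective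
  cases w with
  | nil => exact absurd rfl h
  | cons a w => exact ⟨a, hasSourceAt_cons a w⟩

theorem exists_eq_ofWord_mul {H : Heap G} {l : List V} (hl : l.Nodup)
    (h : ∀ v ∈ l, H.HasSourceAt v) : ∃ K, H = ofWord G l * K := by
  induction l generalizing H with
  | nil => exact ⟨H, by simp⟩
  | cons a l ih =>
    rw [List.nodup_cons] at hl
    obtain ⟨K, rfl⟩ := h a (by simp)
    obtain ⟨K', rfl⟩ := ih (H := K) hl.2 fun v hv => by
      rcases (h v (by simp [hv])).of_mul with hs | ⟨-, -, hs⟩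
      · rw [hasSourceAt_singleton] at hs
        subst hs
        exact absurd hv hl.1
      · exact hs
    exact ⟨K', by rw [ofWord_cons a l, mul_assoc]⟩

theorem ofWord_left_cancel {l : List V} {A B : Heap G}
    (h : ofWord G l * A = ofWord G l * B) : A = B := by
  induction l with
  | nil => simpa using h
  | cons a l ih =>
    rw [ofWord_cons, mul_assoc, mul_assoc] at h
    exact ih (cons_left_cancel h)

theorem hasSourceAt_ofWord_mul {l : List V} (hl : ∀ u ∈ l, ∀ v ∈ l, ¬ G.Adj u v) (K : Heap G)
    {v : V} (hv : v ∈ l) : (ofWord G l * K).HasSourceAt v := by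
  obtain ⟨x, y, rfl⟩ := List.append_of_mem hv
  refine HasSourceAt.mul_right ?_ K
  rw [ofWord_append]
  refine HasSourceAt.mul_left (fun b hb => hl v hv b ?_) (hasSourceAt_cons v y)
  rw [mem_content_ofWord] at hb
  simp [hb]

theorem HasSourceAt.not_adj {H : Heap G} {u v : V} (hu : H.HasSourceAt u)
    (hv : H.HasSourceAt v) : ¬ G.Adj u v := by
  obtain ⟨K, rfl⟩ := hu
  rcases hv.of_mul with h | ⟨-, h, -⟩
  · rw [hasSourceAt_singleton] at h
    simp [h]
  · exact h u (by simp [content_ofWord])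

theorem IsPyramidAt.hasSourceAt {H : Heap G} {v : V} (h : H.IsPyramidAt v) : H.HasSourceAt v :=
  (h v).2 rfl

theorem IsPyramidAt.mem_content {H : Heap G} {v : V} (h : H.IsPyramidAt v) : v ∈ H.content :=
  h.hasSourceAt.mem_content

theorem IsPyramidAt.ne_one {H : Heap G} {v : V} (h : H.IsPyramidAt v) : H ≠ 1 := by
  rintro rfl
  exact not_hasSourceAt_one v h.hasSourceAt

theorem IsPyramidAt.of_mul {A B : Heap G} {v : V} (h : (A * B).IsPyramidAt v) (hA : A ≠ 1) :
    A.IsPyramidAt v := by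
  obtain ⟨a, ha⟩ := exists_hasSourceAt hA
  have hav := (h a).1 (ha.mul_right B)
  subst hav
  exact fun u => ⟨fun hu => (h u).1 (hu.mul_right B), fun hu => hu ▸ ha⟩

theorem isPyramidAt_singleton (v : V) : (ofWord G [v]).IsPyramidAt v :=
  fun _ => hasSourceAt_singleton

theorem IsPyramidAt.mul_singleton {W : Heap G} {v a : V} (h : W.IsPyramidAt v)
    (ha : ∃ b ∈ W.content, b = a ∨ G.Adj b a) : (W * ofWord G [a]).IsPyramidAt v := by
  refine fun u => ⟨fun hu => ?_, fun hu => (h u).2 hu |>.mul_right _⟩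
  rcases hu.of_mul with hu | ⟨h1, h2, h3⟩
  · exact (h u).1 hu
  · rw [hasSourceAt_singleton] at h3
    subst h3
    obtain ⟨b, hb, rfl | hb'⟩ := ha
    · exact absurd hb h1
    · exact absurd hb' (h2 b hb)

/-- The content of a pyramid induces a connected subgraph. -/
theorem IsPyramidAt.connected {H : Heap G} {v : V} (h : H.IsPyramidAt v) (t : Set V)
    (hadj : ∀ a ∈ H.content, ∀ b ∈ H.content, a ∈ t → b ∉ t → ¬ G.Adj a b) :
    (∀ a ∈ H.content, a ∈ t) ∨ ∀ a ∈ H.content, a ∉ t := by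
  classical
  -- In any word of `H`, the first letter lying in `r` is independent of all earlier letters, so it
  -- is a source, and the only source is at `v`.
  have key : ∀ r : Set V, (∀ a ∈ H.content, ∀ b ∈ H.content, a ∈ r → b ∉ r → ¬ G.Adj a b) →
      v ∉ r → ∀ a ∈ H.content, a ∉ r := by
    intro r hr hv a ha har
    obtain ⟨w, rfl⟩ := H.ofWord_surjective
    simp only [mem_content_ofWord] at hr ha
    obtain ⟨x, b, y, rfl, hx, hb⟩ : ∃ x b y, w = x ++ b :: y ∧ (∀ c ∈ x, c ∉ r) ∧ b ∈ r := by
      clear hr h hadj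
      induction w with
      | nil => simp at ha
      | cons c w ih =>
        by_cases hc : c ∈ r
        · exact ⟨[], c, w, rfl, by simp, hc⟩
        · rcases List.mem_cons.1 ha with rfl | ha
          · exact absurd har hc
          · obtain ⟨x, b, y, rfl, hx, hb⟩ := ih ha
            refine ⟨c :: x, b, y, rfl, ?_, hb⟩
            intro d hd
            rcases List.mem_cons.1 hd with rfl | hd
            · exact hc
            · exact hx d hd
    have hs : (ofWord G (x ++ b :: y)).HasSourceAt b := by
      rw [ofWord_append]
      refine HasSourceAt.mul_left (fun c hc => ?_) (hasSourceAt_cons b y)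
      rw [mem_content_ofWord] at hc
      exact hr b (by simp) c (by simp [hc]) hb (hx c hc)
    exact hv ((h b).1 hs ▸ hb)
  by_cases hv : v ∈ t
  · left
    intro a ha
    have := key tᶜ (fun a ha b hb hat hbt hab => hadj b hb a ha (not_not.1 hbt) hat hab.symm)
      (fun hh => hh hv) a ha
    exact not_not.1 this
  · exact Or.inr (key t hadj hv)

/-- Splitting off the part of `W ∘ [x]` that is reachable from the source of the pyramid `W`. -/
theorem exists_pyramid_split [DecidableEq V] {W : Heap G} {v : V} (hW : W.IsPyramidAt v)
    (x : List V) :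
    ∃ U' W' : Heap G, W * ofWord G x = U' * W' ∧ W'.IsPyramidAt v ∧ U'.content.count v = 0 ∧
      U'.size ≤ x.length ∧ W.content ≤ W'.content ∧
      (U'.size < x.length ∨ ∀ a ∈ x, ∀ b ∈ W.content, b ≠ a ∧ ¬ G.Adj b a) := by
  -- Reading `x` from the left, a letter equal or adjacent to a letter of `W'` is reachable from the
  -- source and joins `W'`; any other letter commutes past `W'` and joins `U'`. The last disjunct
  -- records whether some letter was absorbed, which is what makes repeated pulling terminate.
  induction x using List.reverseRecOn with
  | nil => exact ⟨1, W, by simp, hW, by simp, by simp, le_rfl, Or.inr (by simp)⟩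
  | append_singleton x a ih =>
    obtain ⟨U', W', h1, h2, h3, h4, h5, h6⟩ := ih
    by_cases ha : ∃ b ∈ W'.content, b = a ∨ G.Adj b a
    · refine ⟨U', W' * ofWord G [a], ?_, h2.mul_singleton ha, h3, ?_, ?_, Or.inl ?_⟩
      · rw [ofWord_append, ← mul_assoc, h1, mul_assoc]
      · simp; omega
      · rw [content_mul]
        exact h5.trans (Multiset.le_add_right _ _)
      · simp; omega
    · push Not at ha
      refine ⟨U' * ofWord G [a], W', ?_, h2, ?_, ?_, h5, ?_⟩
      · rw [ofWord_append, ← mul_assoc, h1, mul_assoc, mul_assoc]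
        rw [comm_of_not_adj fun b hb hab => (ha b hb).2 hab.symm]
      · have hva : v ≠ a := (ha v h2.mem_content).1
        simp [content_ofWord, h3, hva]
      · simp [size_ofWord, h4]
      · rcases h6 with h6 | h6
        · left
          simp [size_ofWord, h6]
        · right
          intro c hc b hb
          rcases List.mem_append.1 hc with hc | hc
          · exact h6 c hc b hb
          · rw [List.mem_singleton] at hc
            subst hc
            exact ha b (Multiset.mem_of_le h5 hb)

/-- Repeatedly pulling at the first piece at `v` turns a heap with connected content into a
pyramid. -/
theorem exists_reflTransGen_pull_pyramid [DecidableEq V] {v : V} (n : ℕ) : ∀ (U W : Heap G),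
    W.IsPyramidAt v → U.content.count v = 0 → U.size ≤ n →
    (∀ t : Set V, (∀ a ∈ (U * W).content, ∀ b ∈ (U * W).content, a ∈ t → b ∉ t → ¬ G.Adj a b) →
      (∀ a ∈ (U * W).content, a ∈ t) ∨ ∀ a ∈ (U * W).content, a ∉ t) →
    ∃ Q : Heap G, Q.IsPyramidAt v ∧ Q.content = (U * W).content ∧
      Relation.ReflTransGen (Pull v 0) (U * W) Q := by
  induction n with
  | zero =>
    intro U W hW _ hn _
    have : U = 1 := eq_one_of_size_eq_zero (Nat.le_zero.1 hn)
    subst this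
    exact ⟨W, hW, by simp, by rw [one_mul]⟩
  | succ n ih =>
    intro U W hW hU hn hc
    by_cases hU1 : U = 1
    · subst hU1
      exact ⟨W, hW, by simp, by rw [one_mul]⟩
    obtain ⟨x, rfl⟩ := U.ofWord_surjective
    obtain ⟨U', W', h1, h2, h3, -, -, h5⟩ := exists_pyramid_split hW x
    have hcont : (U' * W').content = (ofWord G x * W).content := by
      rw [← h1, content_mul, content_mul, add_comm]
    -- If nothing were absorbed, the vertices of `W` would be separated from those of `x`, against
    -- the connectedness `hc`.
    have hsize : U'.size < x.length := by
      refine h5.resolve_right fun h5 => ?_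
      have hsep : ∀ a ∈ (ofWord G x * W).content, ∀ b ∈ (ofWord G x * W).content,
          a ∈ W.content → b ∉ W.content → ¬ G.Adj a b := by
        intro a _ b hb haW hbW
        rw [content_mul, Multiset.mem_add, mem_content_ofWord] at hb
        exact (h5 b (hb.resolve_right hbW) a haW).2
      rcases hc {a | a ∈ W.content} hsep with h | h
      · cases x with
        | nil => exact hU1 rfl
        | cons a x =>
          have haW : a ∈ W.content := h a (by simp [content_ofWord])
          exact (h5 a (by simp) a haW).1 rfl
      · exact h v (by simp [hW.mem_content]) hW.mem_content
    rw [size_ofWord] at hn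
    obtain ⟨Q, hQ1, hQ2, hQ3⟩ := ih U' W' h2 h3 (by omega) (by rwa [hcont])
    refine ⟨Q, hQ1, hQ2.trans hcont, Relation.ReflTransGen.head ?_ hQ3⟩
    exact ⟨ofWord G x, W, hW, hU, rfl, h1.symm⟩

/-- A pyramid has a rotation at every vertex at which it has a piece. -/
theorem IsPyramidAt.exists_rotation [DecidableEq V] {P : Heap G} {u v : V}
    (hP : P.IsPyramidAt u) (hv : v ∈ P.content) (huv : v ≠ u) :
    ∃ Q, P.IsRotation Q ∧ Q.IsPyramidAt v := by
  obtain ⟨w, rfl⟩ := P.ofWord_surjective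
  rw [mem_content_ofWord] at hv
  obtain ⟨x, y, rfl, hx⟩ := List.eq_append_cons_of_mem hv
  obtain ⟨U', W', h1, h2, h3, -⟩ := exists_pyramid_split (isPyramidAt_singleton (G := G) v) y
  have he : ofWord G (x ++ v :: y) = (ofWord G x * U') * W' := by
    rw [ofWord_append, ofWord_cons, h1, mul_assoc]
  rw [he] at hP ⊢
  obtain ⟨Q, hQ1, hQ2, hQ3⟩ := exists_reflTransGen_pull_pyramid (v := v) _ (ofWord G x * U') W' h2
    (by simp [content_ofWord, hx, h3]) le_rfl hP.connected
  refine ⟨Q, ?_, hQ1⟩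
  -- A rotation needs at least one pull. With no pull at all, `Q` would be the original pyramid,
  -- whose source is at `u ≠ v`.
  rcases hQ3.cases_head with h | ⟨H, hH1, hH2⟩
  · exact absurd ((hP v).1 (h ▸ hQ1.hasSourceAt)) huv
  · exact ⟨⟨v, hQ1⟩, v, 0, H, hH1, hH2⟩

end Heap

end HeapSources

/-! ### Standard words and Lyndon heaps -/

section LyndonHeaps

variable {V : Type*} [LinearOrder V] {G : SimpleGraph V}

namespace Heap

theorem ofWord_std (H : Heap G) : ofWord G H.std = H :=
  H.exists_isGreatest_word.choose_spec.1

theorem le_std (w : List V) : w ≤ (ofWord G w).std :=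
  (ofWord G w).exists_isGreatest_word.choose_spec.2 rfl

theorem std_injective : Function.Injective (std : Heap G → List V) :=
  Function.LeftInverse.injective ofWord_std

theorem length_std (H : Heap G) : H.std.length = H.size := by
  rw [← size_ofWord (G := G), ofWord_std]

theorem mem_std {H : Heap G} {v : V} : v ∈ H.std ↔ v ∈ H.content := by
  rw [← mem_content_ofWord (G := G), ofWord_std]

/-- Standard words: the lexicographically largest words of heaps. -/
def IsStd (G : SimpleGraph V) (w : List V) : Prop := (ofWord G w).std = w

theorem isStd_std (H : Heap G) : IsStd G H.std := by
  rw [IsStd, ofWord_std]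

theorem isStd_iff {w : List V} : IsStd G w ↔ ∀ x, ofWord G x = ofWord G w → x ≤ w := by
  refine ⟨fun h x hx => ?_, fun h => le_antisymm (h _ (ofWord_std _)) (le_std w)⟩
  rw [IsStd, ← hx] at h
  exact (le_std (G := G) x).trans h.le

theorem IsStd.eq_of_ofWord_eq {x y : List V} (hx : IsStd G x) (hy : IsStd G y)
    (h : ofWord G x = ofWord G y) : x = y := by
  rw [← hx, ← hy, h]

theorem IsStd.of_append_right {x y : List V} (h : IsStd G (x ++ y)) : IsStd G y := by
  rw [isStd_iff] at h ⊢
  intro z hz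
  have := h (x ++ z) (by rw [ofWord_append, ofWord_append, hz])
  rw [← not_lt] at this ⊢
  rwa [lex_append_left_iff] at this

theorem IsStd.of_append_left {x y : List V} (h : IsStd G (x ++ y)) : IsStd G x := by
  rw [isStd_iff] at h ⊢
  intro z hz
  exact lex_append_le_of_length_eq (length_eq_of_ofWord_eq hz)
    (h (z ++ y) (by rw [ofWord_append, ofWord_append, hz]))

theorem IsStd.of_cons {a : V} {x : List V} (h : IsStd G (a :: x)) : IsStd G x :=
  IsStd.of_append_right (x := [a]) h

/-- Otherwise moving `b` to the front would give a larger word of the same heap. -/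
theorem IsStd.le_of_not_adj {a b : V} {x y : List V} (h : IsStd G (a :: x ++ b :: y))
    (hb : ∀ c ∈ a :: x, ¬ G.Adj c b) : b ≤ a := by
  rw [isStd_iff] at h
  have := h (b :: (a :: x) ++ y) (by
    rw [ofWord_append, ofWord_append, ofWord_cons b y, ofWord_cons b (a :: x),
      ofWord_comm fun c hc hbc => hb c hc hbc.symm, mul_assoc])
  rw [← not_lt] at this ⊢
  intro hab
  exact this (by
    rw [List.cons_append, List.cons_append, List.cons_lt_cons_iff]
    exact Or.inl hab)

theorem isStd_nil : IsStd G ([] : List V) := by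
  rw [isStd_iff]
  intro x hx
  rw [List.length_eq_zero_iff.1 (length_eq_of_ofWord_eq hx)]

/-- A product of standard words is standard if the second one starts with a letter that is
minimal in the first one. -/
theorem IsStd.append {x y : List V} (hx : IsStd G x) (hy : IsStd G y)
    (h : ∀ b z, y = b :: z → ∀ a ∈ x, b ≤ a) : IsStd G (x ++ y) := by
  induction x with
  | nil => exact hy
  | cons a x ih =>
    have ih' := ih hx.of_cons fun b z hb c hc => h b z hb c (by simp [hc])
    rw [isStd_iff] at ih' ⊢
    intro w hw
    cases w with
    | nil => exact lex_le_of_prefix List.nil_prefix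
    | cons c w =>
      -- The first letter `c` of a competing word is a source, so it occurs in `a :: x ++ y`
      -- independent of everything before it. If it occurs in `a :: x`, standardness there gives `c
      -- ≤ a`; if it occurs in `y`, it is at most the first letter of `y`, which is at most `a`.
      have hca : c ≤ a := by
        have hs : (ofWord G (a :: x ++ y)).HasSourceAt c := by
          rw [← hw]
          exact hasSourceAt_cons c w
        obtain ⟨p, q, hpq, hp1, hp2⟩ := hs.exists_eq_append
        cases p with
        | nil => simp at hpq; exact hpq.1.ge
        | cons a' p =>
          simp only [List.cons_append, List.cons.injEq] at hpq
          obtain ⟨rfl, hpq⟩ := hpq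
          rcases List.append_eq_append_iff.1 hpq with ⟨s, rfl, he⟩ | ⟨s, rfl, he⟩
          · cases s with
            | nil => exact h c q (by simpa using he) a (by simp)
            | cons b s =>
              refine (IsStd.le_of_not_adj (he ▸ hy) fun d hd => hp2 d ?_).trans
                (h b _ he a (by simp))
              simp only [List.mem_cons, List.mem_append] at hd ⊢
              tauto
          · cases s with
            | nil => exact h c q (by simpa using he.symm) a (by simp)
            | cons b s =>
              simp only [List.cons_append, List.cons.injEq] at he
              obtain ⟨rfl, he⟩ := he
              exact IsStd.le_of_not_adj (a := a) (b := c) hx hp2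
      rcases hca.lt_or_eq with hca | rfl
      · refine le_of_lt ?_
        rw [List.cons_append, List.cons_lt_cons_iff]
        exact Or.inl hca
      · refine List.cons_le_cons c (ih' w (cons_left_cancel (a := c) ?_))
        rw [← ofWord_cons, ← ofWord_cons, hw, List.cons_append]

/-- Another source `u` could be moved to the front, so `u ≤ m` by maximality of the word, while `m`
is its smallest letter. -/
theorem IsStd.isPyramidAt {m : V} {w : List V} (h : IsStd G (m :: w)) (hm : ∀ a ∈ w, m ≤ a) :
    (ofWord G (m :: w)).IsPyramidAt m := by
  refine fun u => ⟨fun hu => ?_, fun hu => hu ▸ hasSourceAt_cons _ _⟩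
  obtain ⟨x, y, hxy, hx1, hx2⟩ := hu.exists_eq_append
  cases x with
  | nil => simp at hxy; exact hxy.1.symm
  | cons a x =>
    simp only [List.cons_append, List.cons.injEq] at hxy
    obtain ⟨rfl, rfl⟩ := hxy
    exact le_antisymm (IsStd.le_of_not_adj (a := m) (b := u) h hx2) (hm u (by simp))

theorem IsPyramidAt.exists_std_eq_cons {H : Heap G} {v : V} (h : H.IsPyramidAt v) :
    ∃ w, H.std = v :: w := by
  have hs := H.ofWord_std
  rcases hw : H.std with _ | ⟨a, w⟩
  · rw [hw] at hs
    exact absurd hs.symm h.ne_one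
  · rw [hw] at hs
    refine ⟨w, ?_⟩
    rw [(h a).1 (hs ▸ hasSourceAt_cons a w)]

theorem std_mul_of_isPyramidAt {A B : Heap G} {m : V} (hB : B.IsPyramidAt m)
    (hm : ∀ a ∈ A.content, m ≤ a) : (A * B).std = A.std ++ B.std := by
  have h : IsStd G (A.std ++ B.std) := by
    refine (isStd_std A).append (isStd_std B) fun b z hb a ha => ?_
    obtain ⟨w, hw⟩ := hB.exists_std_eq_cons
    rw [hw] at hb
    rw [← (List.cons.inj hb).1]
    exact hm a (mem_std.1 ha)
  rw [← h, ofWord_append, ofWord_std, ofWord_std]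

theorem std_pow_of_isPyramidAt {A : Heap G} {m : V} (hA : A.IsPyramidAt m)
    (hm : ∀ a ∈ A.content, m ≤ a) (k : ℕ) : (A ^ k).std = (List.replicate k A.std).flatten := by
  induction k with
  | zero =>
    rw [pow_zero, List.replicate_zero, List.flatten_nil]
    exact isStd_nil (G := G)
  | succ k ih =>
    have hc : ∀ a ∈ (A ^ k).content, m ≤ a := by
      clear ih
      induction k with
      | zero => simp
      | succ k ih =>
        intro a ha
        rw [pow_succ, content_mul, Multiset.mem_add] at ha
        exact ha.elim (ih a) (hm a)
    rw [pow_succ, std_mul_of_isPyramidAt hA hc, ih, List.replicate_succ']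
    simp

/-- The source must sit at the smallest vertex `f`, as a rotation at a smaller vertex would be
smaller. Cut the standard word as `u ++ w`. If `w` does not start with `f`, the first letters
decide. If it does, `w ++ u` is the standard word of a rotation, so minimality gives `≤`, and
aperiodicity excludes equality. -/
theorem IsLyndon.isLyndonWord_std {L : Heap G} (h : L.IsLyndon) : IsLyndonWord L.std := by
  obtain ⟨⟨f, hf⟩, hap, hmin⟩ := h
  obtain ⟨l, hl⟩ := hf.exists_std_eq_cons
  have hfmin : ∀ a ∈ L.std, f ≤ a := by
    intro a ha
    by_contra hlt
    rw [not_le] at hlt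
    obtain ⟨Q, hQ1, hQ2⟩ := hf.exists_rotation (mem_std.1 ha) hlt.ne
    obtain ⟨q, hq⟩ := hQ2.exists_std_eq_cons
    have := hmin Q hQ1
    rw [hl, hq, ← not_lt, List.cons_lt_cons_iff] at this
    exact this (Or.inl hlt)
  refine ⟨by simp [hl], fun u w hu hw huw => ?_⟩
  have hstd := isStd_std L
  rw [huw] at hstd
  obtain ⟨c, w', rfl⟩ := List.exists_cons_of_ne_nil hw
  obtain ⟨f', u', rfl⟩ := List.exists_cons_of_ne_nil hu
  have hff : f = f' := (List.cons.inj (hl.symm.trans huw)).1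
  subst hff
  have hmem : ∀ a, a ∈ u' ∨ a ∈ w' → f ≤ a := fun a ha => hfmin a (by
    rw [huw]
    simp only [List.mem_append, List.mem_cons]
    tauto)
  have hfc : f ≤ c := hfmin c (by simp [huw])
  rcases hfc.lt_or_eq with hfc | rfl
  · rw [huw, List.cons_append, List.cons_append, List.cons_lt_cons_iff]
    exact Or.inl hfc
  have hP := hstd.of_append_right.isPyramidAt (fun a ha => hmem a (Or.inr ha))
  have hP' := hstd.of_append_left.isPyramidAt (fun a ha => hmem a (Or.inl ha))
  have hwu : IsStd G (f :: w' ++ f :: u') := by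
    refine hstd.of_append_right.append hstd.of_append_left fun b z hb a ha => ?_
    rw [← (List.cons.inj hb).1]
    rcases List.mem_cons.1 ha with rfl | ha
    · exact le_rfl
    · exact hmem a (Or.inr ha)
  have hPQ : (ofWord G (f :: w' ++ f :: u')).IsPyramidAt f := by
    refine IsStd.isPyramidAt (w := w' ++ f :: u') hwu fun a ha => ?_
    simp only [List.mem_append, List.mem_cons] at ha
    rcases ha with ha | rfl | ha
    · exact hmem a (Or.inr ha)
    · exact le_rfl
    · exact hmem a (Or.inl ha)
  have hrot : L.IsRotation (ofWord G (f :: w' ++ f :: u')) :=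
    ⟨⟨f, hPQ⟩, f, _, _, ⟨ofWord G (f :: u'), ofWord G (f :: w'), hP, rfl, by
      rw [← ofWord_append, ← huw, ofWord_std], rfl⟩, by
      rw [← ofWord_append]⟩
  have hle := hmin _ hrot
  rw [hwu] at hle
  rcases hle.lt_or_eq with hle | hle
  · exact hle
  -- In the case of equality the two pieces of the word commute, hence are powers of one word, and
  -- `L` is a proper power.
  exfalso
  obtain ⟨z, i, j, hi, hj⟩ := exists_power_of_append_comm _ _ _ le_rfl (huw.symm.trans hle)
  have hi0 : i ≠ 0 := by
    rintro rfl
    simp at hi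
  have hj0 : j ≠ 0 := by
    rintro rfl
    simp at hj
  refine hap (ofWord G z) (i + j) (by omega) ?_
  rw [← L.ofWord_std, huw, hi, hj, ← List.flatten_append, ← List.replicate_add, ofWord_flatten]
  simp

/-- Pyramids at `v` are where pulling stabilizes: a nonempty left factor `U` would contain the
source, yet it has no piece at `v`. -/
theorem IsPyramidAt.eq_of_pull {H H' : Heap G} {v : V} (h : H.IsPyramidAt v)
    (hp : Pull v 0 H H') : H' = H := by
  obtain ⟨U, W, -, hU, rfl, rfl⟩ := hp
  have hU1 : U = 1 := by
    by_contra hU1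
    exact Multiset.count_eq_zero.1 hU (h.of_mul hU1).mem_content
  rw [hU1, one_mul, mul_one]

theorem IsPyramidAt.eq_of_reflTransGen_pull {H Q : Heap G} {v : V} (h : H.IsPyramidAt v)
    (hp : Relation.ReflTransGen (Pull v 0) H Q) : Q = H := by
  induction hp with
  | refl => rfl
  | tail _ hbc ih =>
    subst ih
    exact h.eq_of_pull hbc

theorem IsPyramidAt.of_std_eq_cons {H : Heap G} {m : V} {w : List V} (h : H.std = m :: w)
    (hm : ∀ a ∈ H.content, m ≤ a) : H.IsPyramidAt m := by
  have h1 := isStd_std H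
  rw [h] at h1
  have := h1.isPyramidAt fun a ha => hm a (mem_std.1 (by simp [h, ha]))
  rwa [← h, ofWord_std] at this

/-- The first letter `m` is minimal, so `L` is a pyramid at `m`. A proper power would have a
periodic standard word. A rotation at another vertex starts with a larger letter, and one at `m` is
`L` itself or is reached by a single pull, its standard word being a cyclic shift of that of `L`. -/
theorem isLyndon_of_isLyndonWord_std {L : Heap G} (h : IsLyndonWord L.std) : L.IsLyndon := by
  obtain ⟨m, l, hl⟩ := List.exists_cons_of_ne_nil h.1
  have hm : ∀ a ∈ L.content, m ≤ a := by
    intro a ha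
    rw [hl] at h
    exact h.head_le a (hl ▸ mem_std.2 ha)
  have hP : L.IsPyramidAt m := .of_std_eq_cons hl hm
  refine ⟨⟨m, hP⟩, ?_, ?_⟩
  · rintro K k hk rfl
    obtain ⟨k, rfl⟩ : ∃ j, k = j + 1 + 1 := ⟨k - 2, by omega⟩
    have hK1 : K ≠ 1 := by
      rintro rfl
      exact hP.ne_one (one_pow _)
    rw [pow_succ'] at hP hm h
    have hK := hP.of_mul hK1
    have hKm : ∀ a ∈ K.content, m ≤ a := fun a ha => hm a (by simp [ha])
    rw [← pow_succ', std_pow_of_isPyramidAt hK hKm, List.replicate_succ, List.flatten_cons] at h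
    have hKn : K.std ≠ [] := by
      intro hn
      have := K.ofWord_std
      rw [hn] at this
      exact hK1 this.symm
    refine (h.2 _ _ hKn ?_ rfl).ne ?_
    · simp [List.replicate_succ, hKn]
    · rw [← List.flatten_cons, ← List.replicate_succ, List.replicate_succ', List.flatten_append]
      simp
  · rintro Q ⟨hQ, v, k, H, ⟨U, W, hW, -, hL, hH⟩, hHQ⟩
    have hHv : H.HasSourceAt v := hH ▸ hW.hasSourceAt.mul_right U
    by_cases hvm : v = m
    · subst hvm
      by_cases hU : U = 1
      · have hHL : H = L := by rw [hH, hL, hU, one_mul, mul_one]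
        subst hHL
        rw [hP.eq_of_reflTransGen_pull hHQ]
      · rw [hL] at hP hm
        simp only [content_mul, Multiset.mem_add] at hm
        have hUP := hP.of_mul hU
        have hHstd := std_mul_of_isPyramidAt hUP fun a ha => hm a (Or.inr ha)
        have hLstd := std_mul_of_isPyramidAt hW fun a ha => hm a (Or.inl ha)
        obtain ⟨x, hx⟩ := hW.exists_std_eq_cons
        obtain ⟨y, hy⟩ := hUP.exists_std_eq_cons
        have hHP : H.IsPyramidAt v := by
          rw [hH]
          refine .of_std_eq_cons (w := x ++ U.std) (by rw [hHstd, hx, List.cons_append]) ?_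
          intro a ha
          rw [content_mul, Multiset.mem_add] at ha
          exact hm a ha.symm
        rw [hHP.eq_of_reflTransGen_pull hHQ, hH, hHstd]
        rw [← hL] at hLstd
        exact (h.2 _ _ (by simp [hy]) (by simp [hx]) hLstd).le
    · have hQv : Q.HasSourceAt v := by
        rcases hHQ.cases_tail with h | ⟨K, -, U', W', hW', -, -, rfl⟩
        · exact h ▸ hHv
        · exact hW'.hasSourceAt.mul_right U'
      obtain ⟨v', hv'⟩ := hQ
      obtain rfl := (hv' v).1 hQv
      obtain ⟨q, hq⟩ := hv'.exists_std_eq_cons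
      refine le_of_lt ?_
      rw [hl, hq, List.cons_lt_cons_iff]
      refine Or.inl (lt_of_le_of_ne (hm v ?_) (Ne.symm hvm))
      rw [hL, content_mul]
      exact Multiset.mem_add.2 (Or.inr hW.mem_content)

theorem isLyndon_iff {L : Heap G} : L.IsLyndon ↔ IsLyndonWord L.std :=
  ⟨IsLyndon.isLyndonWord_std, isLyndon_of_isLyndonWord_std⟩

/-- A Lyndon word starts with its smallest letter and the first letters of the factors decrease
weakly, so `IsStd.append` applies at each junction. -/
theorem isStd_flatten_std {l : List (Heap G)} (hl : ∀ L ∈ l, L.IsLyndon)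
    (hp : l.Pairwise (fun A B => B.std ≤ A.std)) : IsStd G (l.map std).flatten := by
  induction l with
  | nil => exact isStd_nil
  | cons L l ih =>
    rw [List.pairwise_cons] at hp
    rw [List.map_cons, List.flatten_cons]
    refine (isStd_std L).append (ih (fun M hM => hl M (by simp [hM])) hp.2) ?_
    intro b z hb a ha
    cases l with
    | nil => simp at hb
    | cons M l =>
      obtain ⟨c, t, hc⟩ := List.exists_cons_of_ne_nil (isLyndon_iff.1 (hl L (by simp))).1
      obtain ⟨d, s, hd⟩ := List.exists_cons_of_ne_nil (isLyndon_iff.1 (hl M (by simp))).1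
      have hLw := isLyndon_iff.1 (hl L (by simp))
      have hML := hp.1 M (by simp)
      simp only [List.map_cons, List.flatten_cons, hd, List.cons_append, List.cons.injEq] at hb
      rw [hc] at hLw ha
      rw [hc, hd, hb.1, ← not_lt, List.cons_lt_cons_iff] at hML
      have hbc : b ≤ c := not_lt.1 fun h => hML (Or.inl h)
      exact hbc.trans (hLw.head_le a ha)

/-- Every heap has a unique Lyndon factorization. -/
theorem existsUnique_isLyndonFactorization (H : Heap G) :
    ∃! l : List (Heap G), H.IsLyndonFactorization l := by
  obtain ⟨l, h1, h2, h3⟩ := exists_lyndonWord_factorization H.std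
  -- Contiguous factors of a standard word are standard, so the Lyndon factors of the word `H.std`
  -- are standard words of Lyndon heaps.
  have hstd : ∀ x ∈ l, IsStd G x := by
    intro x hx
    obtain ⟨s, t, rfl⟩ := List.append_of_mem hx
    have := isStd_std H
    rw [← h3, List.flatten_append, List.flatten_cons] at this
    exact this.of_append_right.of_append_left
  refine ⟨l.map (ofWord G), ⟨?_, ?_, ?_⟩, ?_⟩
  · intro L hL
    obtain ⟨x, hx, rfl⟩ := List.mem_map.1 hL
    rw [isLyndon_iff, hstd x hx]
    exact h1 x hx
  · rw [List.pairwise_map]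
    refine h2.imp_of_mem fun {a b} ha hb hab => ?_
    rw [hstd a ha, hstd b hb]
    exact hab
  · rw [← ofWord_flatten, h3, ofWord_std]
  · rintro l' ⟨h1', h2', h3'⟩
    -- Conversely, the standard words of any Lyndon factorization concatenate to a standard word of
    -- `H`, which is `H.std`; uniqueness for words then applies.
    have hl' : l'.map std = l := by
      refine lyndonWord_factorization_unique _ _ ?_ ?_ h1 h2 ?_
      · intro y hy
        obtain ⟨L, hL, rfl⟩ := List.mem_map.1 hy
        exact isLyndon_iff.1 (h1' L hL)
      · rwa [List.pairwise_map]
      · rw [h3]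
        refine (isStd_flatten_std h1' h2').eq_of_ofWord_eq (isStd_std H) ?_
        rw [ofWord_std, ofWord_flatten, ← h3', List.map_map]
        simp [Function.comp_def, ofWord_std]
    rw [← hl', List.map_map]
    simp [Function.comp_def, ofWord_std]

end Heap

end LyndonHeaps

/-! ### The multiset of Lyndon factors -/

section LyndonFactors

variable {V : Type*} [LinearOrder V] {G : SimpleGraph V}

namespace Heap

/-- The multiset of the Lyndon factors of a heap. -/
noncomputable def lyndonFactors (H : Heap G) : Multiset (Heap G) :=
  (H.existsUnique_isLyndonFactorization.choose : List (Heap G))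

theorem IsLyndonFactorization.coe_eq {H : Heap G} {f : List (Heap G)}
    (h : H.IsLyndonFactorization f) : (f : Multiset (Heap G)) = H.lyndonFactors := by
  rw [lyndonFactors, H.existsUnique_isLyndonFactorization.choose_spec.2 f h]

theorem exists_isLyndonFactorization (H : Heap G) :
    ∃ f, H.IsLyndonFactorization f ∧ (f : Multiset (Heap G)) = H.lyndonFactors :=
  ⟨_, H.existsUnique_isLyndonFactorization.choose_spec.1, rfl⟩

theorem isLyndon_of_mem_lyndonFactors {H L : Heap G} (h : L ∈ H.lyndonFactors) :
    L.IsLyndon := by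
  obtain ⟨f, hf, he⟩ := H.exists_isLyndonFactorization
  rw [← he, Multiset.mem_coe] at h
  exact hf.1 L h

theorem content_eq_sum (H : Heap G) : H.content = (H.lyndonFactors.map content).sum := by
  obtain ⟨f, hf, he⟩ := H.exists_isLyndonFactorization
  rw [← he, ← hf.2.2, content_list_prod]
  simp

theorem size_eq_sum (H : Heap G) : H.size = (H.lyndonFactors.map size).sum := by
  have := congrArg Multiset.card H.content_eq_sum
  rw [size, this]
  generalize H.lyndonFactors = m
  induction m using Multiset.induction with
  | empty => rfl
  | cons L m ih => simp [ih, size]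

theorem mem_content_iff {H : Heap G} {v : V} :
    v ∈ H.content ↔ ∃ L ∈ H.lyndonFactors, v ∈ L.content := by
  rw [content_eq_sum]
  generalize H.lyndonFactors = m
  induction m using Multiset.induction with
  | empty => simp
  | cons L m ih => simp [ih]

theorem lyndonFactors_injective : Function.Injective (lyndonFactors : Heap G → _) := by
  intro H K h
  obtain ⟨f, hf, he⟩ := H.exists_isLyndonFactorization
  obtain ⟨g, hg, he'⟩ := K.exists_isLyndonFactorization
  rw [← he, ← he', Multiset.coe_eq_coe] at h
  rw [← hf.2.2, ← hg.2.2]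
  congr 1
  exact h.eq_of_pairwise (fun a b _ _ h1 h2 => std_injective (le_antisymm h2 h1)) hf.2.1 hg.2.1

theorem exists_lyndonFactors_eq (m : Multiset (Heap G)) (hm : ∀ L ∈ m, L.IsLyndon) :
    ∃ H : Heap G, H.lyndonFactors = m := by
  induction m using Quotient.inductionOn with | _ f
  have hp : (f.mergeSort fun A B => decide (B.std ≤ A.std)).Pairwise
      (fun A B => B.std ≤ A.std) := by
    have := List.pairwise_mergeSort (le := fun A B : Heap G => decide (B.std ≤ A.std))
      (fun a b c h1 h2 => by simp only [decide_eq_true_eq] at *; exact h2.trans h1)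
      (fun a b => by simpa using le_total _ _) f
    simpa using this
  have hperm := List.mergeSort_perm f fun A B => decide (B.std ≤ A.std)
  refine ⟨(f.mergeSort fun A B => decide (B.std ≤ A.std)).prod, ?_⟩
  rw [← IsLyndonFactorization.coe_eq
    (f := f.mergeSort fun A B => decide (B.std ≤ A.std)) ⟨?_, hp, rfl⟩]
  · exact Multiset.coe_eq_coe.2 hperm
  · intro L hL
    exact hm L (hperm.mem_iff.1 hL)

theorem IsLyndon.size_pos {L : Heap G} (h : L.IsLyndon) : 0 < L.size := by
  rw [← length_std]
  exact List.length_pos_iff.2 (isLyndon_iff.1 h).1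

end Heap

end LyndonFactors

/-! ### Counting heaps and stable sets -/

section Counting

variable {V : Type*} [Fintype V] {G : SimpleGraph V}

theorem finite_heap_size (G : SimpleGraph V) (n : ℕ) : {H : Heap G | H.size = n}.Finite := by
  refine (Set.finite_range (fun f : Fin n → V => Heap.ofWord G (List.ofFn f))).subset ?_
  rintro H rfl
  obtain ⟨w, rfl⟩ := H.ofWord_surjective
  rw [Heap.size_ofWord]
  exact ⟨w.get, by simp⟩

/-- The heaps with `n` pieces. -/
noncomputable def heapFinset (G : SimpleGraph V) (n : ℕ) : Finset (Heap G) :=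
  (finite_heap_size G n).toFinset

@[simp] theorem mem_heapFinset {n : ℕ} {H : Heap G} : H ∈ heapFinset G n ↔ H.size = n := by
  simp [heapFinset]

open Classical in
/-- The stable sets with `n` vertices. -/
noncomputable def stableFinset (G : SimpleGraph V) (n : ℕ) : Finset (Finset V) :=
  {S | S.card = n ∧ ∀ u ∈ S, ∀ v ∈ S, ¬ G.Adj u v}

@[simp] theorem mem_stableFinset {n : ℕ} {S : Finset V} :
    S ∈ stableFinset G n ↔ S.card = n ∧ ∀ u ∈ S, ∀ v ∈ S, ¬ G.Adj u v := by
  simp [stableFinset]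

open Classical in
/-- The vertices at which a heap has pieces. -/
noncomputable def Heap.supp (H : Heap G) : Finset V := H.content.toFinset

omit [Fintype V] in
theorem Heap.mem_supp {H : Heap G} {v : V} : v ∈ H.supp ↔ v ∈ H.content := by
  simp [Heap.supp]

open Classical in
/-- The vertices at which a heap has sources. -/
noncomputable def Heap.sources (H : Heap G) : Finset V := {v | H.HasSourceAt v}

open Classical in
-- The pair `(S, K)` corresponds to the heap `S ∘ K` with a marked set `S` of `i` of its sources:
-- sources are pairwise nonadjacent, can be split off together, and leave `K` by left cancellation.
theorem card_stable_mul_card_heap (W : Finset V) (i j : ℕ) :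
    ((stableFinset G i).filter (· ⊆ W)).card * ((heapFinset G j).filter (·.supp ⊆ W)).card =
      ∑ H ∈ (heapFinset G (i + j)).filter (·.supp ⊆ W), H.sources.card.choose i := by
  rw [← Finset.card_product]
  simp_rw [← Finset.card_powersetCard]
  rw [← Finset.card_sigma]
  refine Finset.card_bij (fun p _ => ⟨Heap.ofWord G p.1.toList * p.2, p.1⟩) ?_ ?_ ?_
  · rintro ⟨S, K⟩ h
    simp only [Finset.mem_product, Finset.mem_filter, mem_stableFinset, mem_heapFinset] at h
    obtain ⟨⟨⟨h1, h2⟩, h3⟩, h4, h5⟩ := h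
    simp only [Finset.mem_sigma, Finset.mem_filter, mem_heapFinset, Finset.mem_powersetCard]
    refine ⟨⟨?_, ?_⟩, ?_, h1⟩
    · simp [Heap.size_ofWord, h1, h4]
    · intro v hv
      rw [Heap.mem_supp, Heap.content_mul, Multiset.mem_add, Heap.mem_content_ofWord,
        Finset.mem_toList] at hv
      exact hv.elim (fun h => h3 h) (fun h => h5 (Heap.mem_supp.2 h))
    · intro v hv
      simp only [Heap.sources, Finset.mem_filter, Finset.mem_univ, true_and]
      exact Heap.hasSourceAt_ofWord_mul (by simpa using h2) K (by simpa using hv)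
  · rintro ⟨S, K⟩ _ ⟨S', K'⟩ _ h
    simp only [Sigma.mk.injEq, heq_eq_eq] at h
    obtain ⟨h1, rfl⟩ := h
    rw [Heap.ofWord_left_cancel h1]
  · rintro ⟨H, S⟩ h
    simp only [Finset.mem_sigma, Finset.mem_filter, mem_heapFinset,
      Finset.mem_powersetCard] at h
    obtain ⟨⟨h1, h2⟩, h3, h4⟩ := h
    have hS : ∀ v ∈ S, H.HasSourceAt v := fun v hv => by
      simpa [Heap.sources] using h3 hv
    obtain ⟨K, rfl⟩ := Heap.exists_eq_ofWord_mul (H := H) (Finset.nodup_toList S) (by simpa using hS)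
    refine ⟨⟨S, K⟩, ?_, rfl⟩
    simp only [Finset.mem_product, Finset.mem_filter, mem_stableFinset, mem_heapFinset]
    refine ⟨⟨⟨h4, fun u hu v hv => (hS u hu).not_adj (hS v hv)⟩, fun v hv => h2 ?_⟩, ?_,
      fun v hv => h2 ?_⟩
    · exact Heap.mem_supp.2 (hS v hv).mem_content
    · simp [Heap.size_ofWord, h4] at h1
      omega
    · rw [Heap.mem_supp] at hv ⊢
      simp [hv]

open Classical in
/-- The Cartier–Foata identity. -/
theorem sum_antidiagonal_stable_heap (W : Finset V) {n : ℕ} (hn : n ≠ 0) :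
    ∑ p ∈ Finset.HasAntidiagonal.antidiagonal n, (-1 : ℤ) ^ p.1 *
      ((stableFinset G p.1).filter (· ⊆ W)).card *
        ((heapFinset G p.2).filter (·.supp ⊆ W)).card = 0 := by
  have h1 : ∀ p ∈ Finset.HasAntidiagonal.antidiagonal n, (-1 : ℤ) ^ p.1 *
      ((stableFinset G p.1).filter (· ⊆ W)).card *
        ((heapFinset G p.2).filter (·.supp ⊆ W)).card =
      ∑ H ∈ (heapFinset G n).filter (·.supp ⊆ W),
        (-1 : ℤ) ^ p.1 * (H.sources.card.choose p.1 : ℤ) := by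
    intro p hp
    rw [mul_assoc, ← Nat.cast_mul, card_stable_mul_card_heap, Finset.HasAntidiagonal.mem_antidiagonal.1 hp,
      Nat.cast_sum, Finset.mul_sum]
  rw [Finset.sum_congr rfl h1, Finset.sum_comm]
  refine Finset.sum_eq_zero fun H hH => ?_
  simp only [Finset.mem_filter, mem_heapFinset] at hH
  rw [Finset.Nat.sum_antidiagonal_eq_sum_range_succ_mk]
  have hle : H.sources.card ≤ n := by
    rw [← hH.1, Heap.size]
    refine le_trans (Finset.card_le_card ?_) (Multiset.toFinset_card_le _)
    intro v hv
    simp only [Heap.sources, Finset.mem_filter, Finset.mem_univ, true_and] at hv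
    exact Multiset.mem_toFinset.2 hv.mem_content
  -- Each heap contributes an alternating sum of binomial coefficients in its number of sources,
  -- which vanishes because a nonempty heap has a source.
  have hpos : H.sources.card ≠ 0 := by
    rw [Finset.card_ne_zero]
    obtain ⟨u, hu⟩ := Heap.exists_hasSourceAt (H := H) (by
      rintro rfl
      exact hn hH.1.symm)
    exact ⟨u, by simpa [Heap.sources] using hu⟩
  rw [← Int.alternating_sum_range_choose_of_ne hpos]
  refine (Finset.sum_subset (Finset.range_mono (by omega)) fun i _ hi => ?_).symm
  rw [Nat.choose_eq_zero_of_lt (by simpa using hi)]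
  simp

end Counting

/-! ### Coefficients of power sums and of their analogues -/

section Coefficients

open MvPowerSeries

theorem hasExpansion_iff {b : Ptn → MvPowerSeries ℕ ℚ} {c : Ptn → ℚ} {f : MvPowerSeries ℕ ℚ} :
    HasExpansion b c f ↔ ∀ d, HasSum (fun l => c l * coeff d (b l)) (coeff d f) := by
  rw [HasExpansion, WithPiTopology.hasSum_iff_hasSum_coeff]
  simp

theorem coeff_powerSum_mul {k : ℕ} (hk : k ≠ 0) (φ : MvPowerSeries ℕ ℚ) (d : ℕ →₀ ℕ) :
    coeff d (powerSum k * φ) =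
      ∑ i ∈ d.support, if k ≤ d i then coeff (d - Finsupp.single i k) φ else 0 := by
  have h := ((summable_powerSum hk).hasSum.mul_right φ)
  rw [WithPiTopology.hasSum_iff_hasSum_coeff] at h
  refine (h d).unique ?_
  have h2 : ∀ i, coeff d (X i ^ k * φ) =
      if k ≤ d i then coeff (d - Finsupp.single i k) φ else 0 := by
    intro i
    rw [X_pow_eq, coeff_monomial_mul]
    simp [Finsupp.single_le_iff]
  simp_rw [h2]
  refine hasSum_sum_of_ne_finset_zero fun i hi => if_neg ?_
  rw [Finsupp.mem_support_iff, not_not] at hi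
  omega

theorem eq_single_of_le_of_degree_le {d : ℕ →₀ ℕ} {i k : ℕ} (h1 : k ≤ d i) (h2 : d.degree ≤ k) :
    d = Finsupp.single i k := by
  have h : d.degree = k := le_antisymm h2 (h1.trans (d.le_degree i))
  have hle : Finsupp.single i k ≤ d := by simpa [Finsupp.single_le_iff] using h1
  have h3 := congrArg Finsupp.degree (tsub_add_cancel_of_le hle)
  rw [map_add, Finsupp.degree_single, h] at h3
  have h4 : d - Finsupp.single i k = 0 := (Finsupp.degree_eq_zero_iff _).1 (by omega)
  rw [← tsub_add_cancel_of_le hle, h4, zero_add]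

open Classical in
theorem coeff_powerSum {k : ℕ} (hk : k ≠ 0) (d : ℕ →₀ ℕ) :
    coeff d (powerSum k) = if ∃ i, d = Finsupp.single i k then 1 else 0 := by
  have h := (summable_powerSum hk).hasSum
  rw [WithPiTopology.hasSum_iff_hasSum_coeff] at h
  refine (h d).unique ?_
  simp_rw [coeff_X_pow]
  split_ifs with hd
  · obtain ⟨i, rfl⟩ := hd
    have h2 : ∀ j, (if Finsupp.single i k = Finsupp.single j k then (1 : ℚ) else 0) =
        if j = i then 1 else 0 := by
      intro j
      simp [Finsupp.single_left_inj hk, eq_comm]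
    simp_rw [h2]
    exact hasSum_ite_eq i 1
  · push Not at hd
    simp [hd, hasSum_zero]

open Classical in
/-- The series `1 / (1 - X i ^ k)`. -/
noncomputable def geomSeries (k i : ℕ) : MvPowerSeries ℕ ℚ :=
  fun d => if (∀ j, j ≠ i → d j = 0) ∧ k ∣ d i then 1 else 0

open Classical in
theorem coeff_geomSeries (k i : ℕ) (d : ℕ →₀ ℕ) : coeff d (geomSeries k i) =
    if (∀ j, j ≠ i → d j = 0) ∧ k ∣ d i then 1 else 0 := rfl

theorem geomSeries_eq_inv {k : ℕ} (hk : k ≠ 0) (i : ℕ) :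
    (1 - (X i : MvPowerSeries ℕ ℚ) ^ k)⁻¹ = geomSeries k i := by
  classical
  symm
  rw [MvPowerSeries.eq_inv_iff_mul_eq_one (by simp [hk])]
  ext d
  rw [mul_sub, mul_one, X_pow_eq, map_sub, coeff_mul_monomial, coeff_geomSeries,
    coeff_geomSeries, coeff_one]
  simp only [Finsupp.single_le_iff, mul_one]
  by_cases hd : ∀ j, j ≠ i → d j = 0
  · have h1 : ∀ j, j ≠ i → (d - Finsupp.single i k) j = 0 := fun j hj => by
      simp [hd j hj]
    have h0 : d = 0 ↔ d i = 0 := by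
      refine ⟨fun h => by simp [h], fun h => Finsupp.ext fun j => ?_⟩
      by_cases hj : j = i
      · rw [hj, h]; rfl
      · exact hd j hj
    have h2 : (d - Finsupp.single i k) i = d i - k := by simp
    simp only [h0, and_iff_right hd, and_iff_right h1, h2]
    by_cases hz : d i = 0
    · simp [hz, hk]
    · by_cases hki : k ≤ d i
      · have : k ∣ d i - k ↔ k ∣ d i := by
          conv_rhs => rw [← Nat.sub_add_cancel hki, Nat.dvd_add_self_right]
        simp [hz, hki, this]
      · have : ¬ k ∣ d i := fun h => hki (Nat.le_of_dvd (Nat.pos_of_ne_zero hz) h)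
        simp [hz, hki, this]
  · have h1 : ¬ ∀ j, j ≠ i → (d - Finsupp.single i k) j = 0 := by
      contrapose! hd
      intro j hj
      have := hd j hj
      simpa [Finsupp.single_apply, Ne.symm hj] using this
    have h0 : d ≠ 0 := by
      rintro rfl
      simp at hd
    simp only [hd, h1, h0, false_and, if_false, ite_self, sub_zero]

open Classical in
theorem coeff_prod_geomSeries (k : ℕ) (s : Finset ℕ) (d : ℕ →₀ ℕ) :
    coeff d (∏ i ∈ s, geomSeries k i) =
      if d.support ⊆ s ∧ ∀ i, k ∣ d i then 1 else 0 := by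
  rw [coeff_prod]
  split_ifs with h
  -- Since the factor at `i` only involves the variable `i`, the sole contributing decomposition of
  -- `d` is the one into its single-variable parts.
  · have hmem : (Finsupp.onFinset s
        (fun i => if i ∈ s then Finsupp.single i (d i) else 0) (by
          intro i hi
          by_contra his
          simp [his] at hi)) ∈ Finset.finsuppAntidiag s d := by
      rw [Finset.mem_finsuppAntidiag]
      refine ⟨?_, Finsupp.support_onFinset_subset⟩
      refine (Finset.sum_congr rfl fun i hi => if_pos hi).trans ?_
      conv_rhs => rw [← Finsupp.sum_single d]
      exact (Finset.sum_subset h.1 fun i _ hi => by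
        rw [Finsupp.notMem_support_iff.1 hi, Finsupp.single_zero]).symm
    rw [Finset.sum_eq_single_of_mem _ hmem]
    · refine Finset.prod_eq_one fun i hi => ?_
      rw [coeff_geomSeries]
      refine if_pos ?_
      simp only [Finsupp.onFinset_apply, if_pos hi]
      refine ⟨fun j hj => by simp [Ne.symm hj], by simpa using h.2 i⟩
    · intro l hl hne
      by_contra h0
      refine hne (Finsupp.ext fun i => ?_)
      rw [Finset.mem_finsuppAntidiag] at hl
      have hP : ∀ i ∈ s, ∀ j, j ≠ i → (l i) j = 0 := by
        intro i hi
        have := Finset.prod_ne_zero_iff.1 h0 i hi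
        rw [coeff_geomSeries] at this
        by_contra hh
        exact this (if_neg fun h => hh h.1)
      simp only [Finsupp.onFinset_apply]
      split_ifs with hi
      · ext j
        rw [Finsupp.single_apply]
        split_ifs with hij
        · subst hij
          rw [← hl.1, Finsupp.finsetSum_apply, Finset.sum_eq_single_of_mem i hi]
          intro j hj hji
          exact hP j hj i (Ne.symm hji)
        · exact hP i hi j (Ne.symm hij)
      · exact Finsupp.notMem_support_iff.1 fun hh => hi (hl.2 hh)
  · refine Finset.sum_eq_zero fun l hl => ?_
    rw [Finset.mem_finsuppAntidiag] at hl
    by_contra h0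
    have hP : ∀ i ∈ s, (∀ j, j ≠ i → (l i) j = 0) ∧ k ∣ (l i) i := by
      intro i hi
      have := Finset.prod_ne_zero_iff.1 h0 i hi
      rw [coeff_geomSeries] at this
      by_contra hh
      exact this (if_neg hh)
    have hd : ∀ j, d j = ∑ i ∈ s, (l i) j := fun j => by
      rw [← hl.1, Finsupp.finsetSum_apply]
    refine h ⟨fun j hj => ?_, fun j => ?_⟩
    · rw [Finsupp.mem_support_iff, hd] at hj
      obtain ⟨i, hi, hij⟩ := Finset.exists_ne_zero_of_sum_ne_zero hj
      by_contra hjs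
      exact hij ((hP i hi).1 j fun hh => hjs (hh ▸ hi))
    · rw [hd]
      refine Finset.dvd_sum fun i hi => ?_
      by_cases hji : j = i
      · rw [hji]
        exact (hP i hi).2
      · rw [(hP i hi).1 j hji]
        exact dvd_zero k

open Classical in
theorem coeff_pbar' {k : ℕ} (hk : k ≠ 0) (d : ℕ →₀ ℕ) :
    coeff d (pbar' k) = if d ≠ 0 ∧ ∀ i, k ∣ d i then 1 else 0 := by
  have h := (multipliable_pbar' hk).hasProd
  simp_rw [geomSeries_eq_inv hk] at h
  have h1 := (WithPiTopology.tendsto_iff_coeff_tendsto _ _ _).1 h d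
  have h2 : coeff d (∏' i, geomSeries k i) = if ∀ i, k ∣ d i then 1 else 0 := by
    refine tendsto_nhds_unique h1 (tendsto_const_nhds.congr' ?_)
    simp only [SummationFilter.unconditional_filter]
    filter_upwards [Filter.eventually_ge_atTop d.support] with s hs
    rw [coeff_prod_geomSeries]
    simp [hs]
  rw [pbar', map_sub]
  simp_rw [geomSeries_eq_inv hk]
  rw [h2, coeff_one]
  by_cases hd : d = 0
  · simp [hd]
  · simp [hd]

end Coefficients

/-! ### Uniqueness of expansions -/

section Uniqueness

open MvPowerSeries

/-- Families like the power sums: `b k` has nonnegative coefficients, its monomials are `k`-th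
powers, and it contains the `k`-th powers of the variables. -/
structure PowerSumLike (b : ℕ → MvPowerSeries ℕ ℚ) : Prop where
  ne_zero : ∀ k d, k ≠ 0 → coeff d (b k) ≠ 0 → d ≠ 0
  dvd : ∀ k d, k ≠ 0 → coeff d (b k) ≠ 0 → ∀ i, k ∣ d i
  nonneg : ∀ k d, k ≠ 0 → 0 ≤ coeff d (b k)
  single_pos : ∀ k i, k ≠ 0 → 0 < coeff (Finsupp.single i k) (b k)

theorem powerSumLike_powerSum : PowerSumLike powerSum where
  ne_zero := by
    classical
    rintro k d hk h rfl
    rw [coeff_powerSum hk, ite_ne_right_iff] at h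
    obtain ⟨⟨i, h⟩, -⟩ := h
    exact hk (Finsupp.single_eq_zero.1 h.symm)
  dvd := by
    classical
    intro k d hk h j
    rw [coeff_powerSum hk, ite_ne_right_iff] at h
    obtain ⟨⟨i, rfl⟩, -⟩ := h
    rw [Finsupp.single_apply]
    split_ifs <;> simp
  nonneg := by
    classical
    intro k d hk
    rw [coeff_powerSum hk]
    split_ifs <;> simp
  single_pos := by
    classical
    intro k i hk
    rw [coeff_powerSum hk, if_pos ⟨i, rfl⟩]
    exact one_pos

theorem powerSumLike_pbar' : PowerSumLike pbar' where
  ne_zero := by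
    classical
    intro k d hk h
    rw [coeff_pbar' hk, ite_ne_right_iff] at h
    exact h.1.1
  dvd := by
    classical
    intro k d hk h
    rw [coeff_pbar' hk, ite_ne_right_iff] at h
    exact h.1.2
  nonneg := by
    classical
    intro k d hk
    rw [coeff_pbar' hk]
    split_ifs <;> simp
  single_pos := by
    classical
    intro k i hk
    rw [coeff_pbar' hk, if_pos]
    · exact one_pos
    · refine ⟨by simpa using hk, fun j => ?_⟩
      rw [Finsupp.single_apply]
      split_ifs <;> simp

/-- The multiset of the exponents of a monomial. -/
def exponents (d : ℕ →₀ ℕ) : Multiset ℕ := d.support.val.map d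

theorem sum_exponents (d : ℕ →₀ ℕ) : (exponents d).sum = d.degree := rfl

theorem card_exponents (d : ℕ →₀ ℕ) : (exponents d).card = d.support.card := by
  simp [exponents]

theorem exponents_single_add {i k : ℕ} (hk : k ≠ 0) {d : ℕ →₀ ℕ} (hi : i ∉ d.support) :
    exponents (Finsupp.single i k + d) = k ::ₘ exponents d := by
  classical
  have hs : (Finsupp.single i k + d).support = insert i d.support := by
    rw [Finsupp.support_add_eq, Finsupp.support_single _ hk]
    · rfl
    · rw [Finsupp.support_single _ hk]
      simpa using hi
  rw [exponents, hs, Finset.insert_val_of_notMem hi, Multiset.map_cons]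
  congr 1
  · rw [Finsupp.notMem_support_iff] at hi
    simp [hi]
  · refine Multiset.map_congr rfl fun j hj => ?_
    have : i ≠ j := by
      rintro rfl
      exact hi hj
    simp [this]

namespace PowerSumLike

variable {b : ℕ → MvPowerSeries ℕ ℚ} (hb : PowerSumLike b)
include hb

/-- Triangularity: each factor `b k` contributes degree at least `k`. In the least total degree each
contributes a pure power `x_i ^ k`, so at most `m.card` variables appear, with equality only if they
are distinct, and then the exponents are the parts. -/
theorem coeff_prod_ne_zero (m : Multiset ℕ) : ∀ (d : ℕ →₀ ℕ), (∀ k ∈ m, k ≠ 0) →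
    coeff d (m.map b).prod ≠ 0 → m.sum ≤ d.degree ∧ (m.sum = d.degree →
      d.support.card ≤ m.card ∧ (d.support.card = m.card → exponents d = m)) := by
  classical
  induction m using Multiset.induction with
  | empty =>
    intro d _ h
    rw [Multiset.map_zero, Multiset.prod_zero, coeff_one, ite_ne_right_iff] at h
    rw [h.1]
    simp [exponents]
  | cons k m ih =>
    intro d hm h
    have hk : k ≠ 0 := hm k (by simp)
    rw [Multiset.map_cons, Multiset.prod_cons, coeff_mul] at h
    obtain ⟨⟨d1, d2⟩, hp, hne⟩ := Finset.exists_ne_zero_of_sum_ne_zero h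
    rw [Finset.HasAntidiagonal.mem_antidiagonal] at hp
    dsimp only at hp hne
    subst hp
    obtain ⟨h1, h2⟩ := ih d2 (fun j hj => hm j (by simp [hj])) (right_ne_zero_of_mul hne)
    have hd1 := left_ne_zero_of_mul hne
    obtain ⟨i, hi⟩ := Finsupp.ne_iff.1 (hb.ne_zero k d1 hk hd1)
    have hki : k ≤ d1 i := Nat.le_of_dvd (Nat.pos_of_ne_zero hi) (hb.dvd k d1 hk hd1 i)
    have hkd : k ≤ d1.degree := hki.trans (d1.le_degree i)
    rw [map_add, Multiset.sum_cons, Multiset.card_cons]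
    refine ⟨by omega, fun he => ?_⟩
    obtain ⟨h3, h4⟩ := h2 (by omega)
    obtain rfl := eq_single_of_le_of_degree_le hki (by omega)
    by_cases hid : i ∈ d2.support
    · have hle : (Finsupp.single i k + d2).support.card ≤ d2.support.card := by
        refine Finset.card_le_card (Finsupp.support_add.trans ?_)
        rw [Finsupp.support_single _ hk]
        exact Finset.union_subset (by simpa using hid) subset_rfl
      exact ⟨by omega, by omega⟩
    · have he := exponents_single_add hk hid
      have hc := congrArg Multiset.card he
      rw [card_exponents, Multiset.card_cons, card_exponents] at hc
      refine ⟨by omega, fun hcc => ?_⟩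
      rw [he, h4 (by omega)]

theorem coeff_prod_nonneg (m : Multiset ℕ) : ∀ (d : ℕ →₀ ℕ), (∀ k ∈ m, k ≠ 0) →
    0 ≤ coeff d (m.map b).prod := by
  classical
  induction m using Multiset.induction with
  | empty =>
    intro d _
    rw [Multiset.map_zero, Multiset.prod_zero, coeff_one]
    split_ifs <;> simp
  | cons k m ih =>
    intro d hm
    rw [Multiset.map_cons, Multiset.prod_cons, coeff_mul]
    exact Finset.sum_nonneg fun p _ => mul_nonneg (hb.nonneg k _ (hm k (by simp)))
      (ih _ fun j hj => hm j (by simp [hj]))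

theorem exists_exponents_eq (m : Multiset ℕ) (hm : ∀ k ∈ m, k ≠ 0) :
    ∃ d : ℕ →₀ ℕ, exponents d = m ∧ 0 < coeff d (m.map b).prod := by
  classical
  induction m using Multiset.induction with
  | empty => exact ⟨0, rfl, by simp⟩
  | cons k m ih =>
    have hk : k ≠ 0 := hm k (by simp)
    have hm' : ∀ j ∈ m, j ≠ 0 := fun j hj => hm j (by simp [hj])
    obtain ⟨d, hd1, hd2⟩ := ih hm'
    obtain ⟨i, hi⟩ := Infinite.exists_notMem_finset d.support
    refine ⟨Finsupp.single i k + d, by rw [exponents_single_add hk hi, hd1], ?_⟩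
    rw [Multiset.map_cons, Multiset.prod_cons, coeff_mul]
    refine lt_of_lt_of_le (mul_pos (hb.single_pos k i hk) hd2) ?_
    exact Finset.single_le_sum (f := fun p : (ℕ →₀ ℕ) × (ℕ →₀ ℕ) =>
      coeff p.1 (b k) * coeff p.2 (m.map b).prod)
      (fun p _ => mul_nonneg (hb.nonneg k _ hk) (hb.coeff_prod_nonneg m _ hm'))
      (a := (Finsupp.single i k, d)) (by simp [Finset.HasAntidiagonal.mem_antidiagonal])

theorem eq_zero_of_hasExpansion {c : Ptn → ℚ} (h : HasExpansion (multiplicative b) c 0) :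
    c = 0 := by
  by_contra hc
  have hpos : ∀ l : Ptn, ∀ k ∈ l.2.parts, k ≠ 0 := fun l k hk => (l.2.parts_pos hk).ne'
  have hcard : ∀ l : Ptn, l.2.parts.card ≤ l.1 := fun l => by
    conv_rhs => rw [← l.2.parts_sum]
    have : ∀ m : Multiset ℕ, (∀ k ∈ m, k ≠ 0) → m.card ≤ m.sum := by
      intro m
      induction m using Multiset.induction with
      | empty => simp
      | cons k m ih =>
        intro hm
        have := ih fun j hj => hm j (by simp [hj])
        have := Nat.pos_of_ne_zero (hm k (by simp))
        rw [Multiset.card_cons, Multiset.sum_cons]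
        omega
    exact this _ (hpos l)
  -- Among the partitions with nonzero coefficient, take one of least size and, within that size, of
  -- greatest length. By triangularity it alone contributes to a monomial whose exponents are its
  -- parts.
  obtain ⟨l, hl, hmin⟩ := (InvImage.wf (fun l : Ptn => toLex (l.1, l.1 - l.2.parts.card))
    (wellFounded_lt (α := ℕ ×ₗ ℕ))).has_min {l | c l ≠ 0} (Function.ne_iff.1 hc)
  obtain ⟨d, hd1, hd2⟩ := hb.exists_exponents_eq l.2.parts (hpos l)
  have hsum := hasExpansion_iff.1 h d
  have hdeg : d.degree = l.1 := by rw [← sum_exponents, hd1, l.2.parts_sum]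
  have hcd : d.support.card = l.2.parts.card := by rw [← card_exponents, hd1]
  have hzero : ∀ m ≠ l, c m * coeff d (multiplicative b m) = 0 := by
    intro m hml
    by_contra hne
    obtain ⟨h1, h2⟩ := hb.coeff_prod_ne_zero m.2.parts d (hpos m) (right_ne_zero_of_mul hne)
    have h3 := hmin m (left_ne_zero_of_mul hne)
    simp only [InvImage, Prod.Lex.toLex_lt_toLex, not_or, not_and, not_lt] at h3
    rw [m.2.parts_sum, hdeg] at h1 h2
    have h4 : m.1 = l.1 := le_antisymm h1 h3.1
    obtain ⟨h5, h6⟩ := h2 h4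
    have h7 := h3.2 h4
    have := hcard m
    have := hcard l
    have h8 := (h6 (by omega)).symm.trans hd1
    apply hml
    obtain ⟨n, m⟩ := m
    obtain ⟨n', l⟩ := l
    dsimp only at h4 h8
    subst h4
    rw [Nat.Partition.ext h8]
  have := (hasSum_single l hzero).unique hsum
  rw [map_zero] at this
  exact mul_ne_zero hl hd2.ne' this

theorem hasExpansion_unique {c c' : Ptn → ℚ} {f : MvPowerSeries ℕ ℚ}
    (h : HasExpansion (multiplicative b) c f) (h' : HasExpansion (multiplicative b) c' f) :
    c = c' := by
  rw [← sub_eq_zero]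
  refine hb.eq_zero_of_hasExpansion ?_
  have := HasSum.sub h h'
  rw [sub_self] at this
  simpa [HasExpansion, sub_smul] using this

end PowerSumLike

end Uniqueness

/-! ### The involution on multiplicative series -/

section Omega

open MvPowerSeries

theorem degree_eq_of_coeff_powerSum_prod_ne_zero (m : Multiset ℕ) : ∀ (d : ℕ →₀ ℕ),
    (∀ k ∈ m, k ≠ 0) → coeff d (m.map powerSum).prod ≠ 0 → d.degree = m.sum := by
  classical
  induction m using Multiset.induction with
  | empty =>
    intro d _ h
    rw [Multiset.map_zero, Multiset.prod_zero, coeff_one, ite_ne_right_iff] at h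
    simp [h.1]
  | cons k m ih =>
    intro d hm h
    rw [Multiset.map_cons, Multiset.prod_cons, coeff_mul] at h
    obtain ⟨⟨d1, d2⟩, hp, hne⟩ := Finset.exists_ne_zero_of_sum_ne_zero h
    rw [Finset.HasAntidiagonal.mem_antidiagonal] at hp
    dsimp only at hp hne
    have h1 := left_ne_zero_of_mul hne
    rw [coeff_powerSum (hm k (by simp)), ite_ne_right_iff] at h1
    obtain ⟨⟨i, rfl⟩, -⟩ := h1
    rw [← hp, map_add, Finsupp.degree_single, Multiset.sum_cons,
      ih d2 (fun j hj => hm j (by simp [hj])) (right_ne_zero_of_mul hne)]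

/-- The graph of the involution in degree `n`. -/
noncomputable def omegaSpan (n : ℕ) : Submodule ℚ (MvPowerSeries ℕ ℚ × MvPowerSeries ℕ ℚ) :=
  Submodule.span ℚ (Set.range fun l : n.Partition =>
    (multiplicative powerSum ⟨n, l⟩,
      ((-1 : ℚ) ^ (n - l.parts.card)) • multiplicative powerSum ⟨n, l⟩))

/-- As `p_λ` is homogeneous of degree `|λ|` and each degree has finitely many partitions, `ω` can be
checked degree by degree. Phrasing it as membership in a span allows recursion without naming
coefficients. -/
theorem isOmega_of_mem_omegaSpan {f g : MvPowerSeries ℕ ℚ}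
    (h : ∀ n, (homogeneousComponent n f, homogeneousComponent n g) ∈ omegaSpan n) :
    IsOmega f g := by
  have h' : ∀ n, ∃ a : n.Partition → ℚ, ∑ l, a l • (multiplicative powerSum ⟨n, l⟩,
      ((-1 : ℚ) ^ (n - l.parts.card)) • multiplicative powerSum ⟨n, l⟩) =
        (homogeneousComponent n f, homogeneousComponent n g) := fun n =>
    (Submodule.mem_span_range_iff_exists_fun ℚ).1 (h n)
  choose a ha using h'
  have key : ∀ (c : Ptn → ℚ) (u : MvPowerSeries ℕ ℚ),
      (∀ n, ∑ l : n.Partition, c ⟨n, l⟩ • multiplicative powerSum ⟨n, l⟩ =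
        homogeneousComponent n u) → HasExpansion (multiplicative powerSum) c u := by
    intro c u hu
    rw [hasExpansion_iff]
    intro d
    have h1 := congrArg (coeff d) (hu d.degree)
    rw [coeff_homogeneousComponent, if_pos rfl, map_sum] at h1
    simp only [map_smul, smul_eq_mul] at h1
    rw [← h1]
    have h2 := hasSum_sum_of_ne_finset_zero (f := fun l : Ptn =>
      c l * coeff d (multiplicative powerSum l))
      (s := (Finset.univ : Finset (d.degree.Partition)).map (Function.Embedding.sigmaMk d.degree))
      (L := SummationFilter.unconditional _) (by
        rintro ⟨n, l⟩ hl
        by_contra hne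
        have := degree_eq_of_coeff_powerSum_prod_ne_zero l.parts d
          (fun k hk => (l.parts_pos hk).ne') (right_ne_zero_of_mul hne)
        rw [l.parts_sum] at this
        subst this
        simp at hl)
    simpa using h2
  refine ⟨fun l => a l.1 l.2, key _ _ fun n => ?_, key _ _ fun n => ?_⟩
  · simpa [Prod.fst_sum] using congrArg Prod.fst (ha n)
  · have := congrArg Prod.snd (ha n)
    simpa [Prod.snd_sum, smul_smul, mul_comm] using this

theorem mul_powerSum_mem_omegaSpan {k m : ℕ} (hk : k ≠ 0) {x y : MvPowerSeries ℕ ℚ}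
    (h : (x, y) ∈ omegaSpan m) :
    (powerSum k * x, ((-1 : ℚ) ^ (k - 1)) • (powerSum k * y)) ∈ omegaSpan (k + m) := by
  let T : MvPowerSeries ℕ ℚ × MvPowerSeries ℕ ℚ →ₗ[ℚ] MvPowerSeries ℕ ℚ × MvPowerSeries ℕ ℚ :=
    LinearMap.prodMap (LinearMap.mulLeft ℚ (powerSum k))
      (((-1 : ℚ) ^ (k - 1)) • LinearMap.mulLeft ℚ (powerSum k))
  have hT : omegaSpan m ≤ (omegaSpan (k + m)).comap T := by
    rw [omegaSpan, Submodule.span_le]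
    rintro _ ⟨l, rfl⟩
    refine Submodule.subset_span ⟨⟨k ::ₘ l.parts, ?_, ?_⟩, ?_⟩
    · intro i hi
      rcases Multiset.mem_cons.1 hi with rfl | hi
      · exact Nat.pos_of_ne_zero hk
      · exact l.parts_pos hi
    · rw [Multiset.sum_cons, l.parts_sum]
    · have hcard : l.parts.card ≤ m := by
        conv_rhs => rw [← l.parts_sum]
        have := Multiset.card_nsmul_le_sum (s := l.parts) (a := 1) fun i hi => l.parts_pos hi
        simpa using this
      -- Adding the part `k` raises `|λ| - ℓ(λ)` by `k - 1`; `hcard` and `k ≠ 0` keep the natural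
      -- subtractions exact.
      have he : k + m - (l.parts.card + 1) = (k - 1) + (m - l.parts.card) := by omega
      simp only [T, multiplicative, Multiset.map_cons, Multiset.prod_cons, Multiset.card_cons, he,
        LinearMap.prodMap_apply, LinearMap.mulLeft_apply, LinearMap.smul_apply, pow_add,
        mul_smul_comm, smul_smul]
  exact hT h

/-- The product `∏ i, g (X i)` of a series `g` with constant coefficient `1`. -/
noncomputable def mulSeries (g : ℕ → ℚ) : MvPowerSeries ℕ ℚ :=
  fun d => ∏ i ∈ d.support, g (d i)

theorem coeff_mulSeries (g : ℕ → ℚ) (d : ℕ →₀ ℕ) :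
    coeff d (mulSeries g) = ∏ i ∈ d.support, g (d i) := rfl

theorem coeff_mulSeries_of_subset {g : ℕ → ℚ} (hg : g 0 = 1) {d : ℕ →₀ ℕ} {s : Finset ℕ}
    (hs : d.support ⊆ s) : coeff d (mulSeries g) = ∏ i ∈ s, g (d i) := by
  rw [coeff_mulSeries]
  refine Finset.prod_subset hs fun i _ hi => ?_
  rw [Finsupp.notMem_support_iff.1 hi, hg]

/-- Newton's identity: `hb` says that `b` is the coefficient sequence of `t g'(t) / g(t)`, and the
Euler operator multiplies `∏ g(x_i)` by `∑ b_k p_k`. -/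
theorem degree_mul_coeff_mulSeries {g b : ℕ → ℚ} (hg : g 0 = 1)
    (hb : ∀ n, n * g n = ∑ k ∈ Finset.Icc 1 n, b k * g (n - k)) (d : ℕ →₀ ℕ) :
    d.degree * coeff d (mulSeries g) =
      ∑ k ∈ Finset.Icc 1 d.degree, b k * coeff d (powerSum k * mulSeries g) := by
  have h1 : ∀ k ∈ Finset.Icc 1 d.degree, b k * coeff d (powerSum k * mulSeries g) =
      ∑ i ∈ d.support, if k ≤ d i then
        b k * coeff (d - Finsupp.single i k) (mulSeries g) else 0 := by
    intro k hk
    rw [coeff_powerSum_mul (by simp at hk; omega), Finset.mul_sum]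
    simp_rw [mul_ite, mul_zero]
  rw [Finset.sum_congr rfl h1, Finset.sum_comm, Finsupp.degree_apply, Nat.cast_sum,
    Finset.sum_mul]
  refine Finset.sum_congr rfl fun i hi => ?_
  rw [← Finset.sum_filter]
  have h2 : (Finset.Icc 1 d.degree).filter (· ≤ d i) = Finset.Icc 1 (d i) := by
    ext k
    have := d.le_degree i
    simp only [Finset.mem_filter, Finset.mem_Icc]
    omega
  rw [← Finsupp.degree_apply, h2, coeff_mulSeries, ← Finset.mul_prod_erase _ _ hi, ← mul_assoc, hb, Finset.sum_mul]
  refine Finset.sum_congr rfl fun k _ => ?_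
  rw [coeff_mulSeries_of_subset hg (s := d.support) ?_, ← Finset.mul_prod_erase _ _ hi, mul_assoc]
  · congr 2
    · simp
    · refine Finset.prod_congr rfl fun j hj => ?_
      have : i ≠ j := (Finset.ne_of_mem_erase hj).symm
      simp [this]
  · intro j hj
    rw [Finsupp.mem_support_iff] at hj ⊢
    rw [Finsupp.tsub_apply] at hj
    omega

theorem coeff_powerSum_mul_homogeneousComponent {k m : ℕ} (hk : k ≠ 0) (φ : MvPowerSeries ℕ ℚ)
    (d : ℕ →₀ ℕ) : coeff d (powerSum k * homogeneousComponent m φ) =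
      if d.degree = k + m then coeff d (powerSum k * φ) else 0 := by
  have hdeg : ∀ i, k ≤ d i → (d - Finsupp.single i k).degree + k = d.degree := by
    intro i hi
    conv_rhs => rw [← tsub_add_cancel_of_le (Finsupp.single_le_iff.2 hi), map_add,
      Finsupp.degree_single]
  rw [coeff_powerSum_mul hk, coeff_powerSum_mul hk]
  simp_rw [coeff_homogeneousComponent]
  split_ifs with hd
  · refine Finset.sum_congr rfl fun i _ => ?_
    by_cases hi : k ≤ d i
    · have := hdeg i hi
      rw [if_pos hi, if_pos hi, if_pos (by omega)]
    · rw [if_neg hi, if_neg hi]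
  · refine Finset.sum_eq_zero fun i _ => ?_
    by_cases hi : k ≤ d i
    · have := hdeg i hi
      rw [if_pos hi, if_neg (by omega)]
    · rw [if_neg hi]

theorem smul_homogeneousComponent_mulSeries {g b : ℕ → ℚ} (hg : g 0 = 1)
    (hb : ∀ n, n * g n = ∑ k ∈ Finset.Icc 1 n, b k * g (n - k)) (n : ℕ) :
    (n : ℚ) • homogeneousComponent n (mulSeries g) = ∑ k ∈ Finset.Icc 1 n,
      b k • (powerSum k * homogeneousComponent (n - k) (mulSeries g)) := by
  ext d
  rw [map_smul, coeff_homogeneousComponent, map_sum, smul_eq_mul]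
  have h1 : ∀ k ∈ Finset.Icc 1 n,
      coeff d (b k • (powerSum k * homogeneousComponent (n - k) (mulSeries g))) =
        if d.degree = n then b k * coeff d (powerSum k * mulSeries g) else 0 := by
    intro k hk
    rw [Finset.mem_Icc] at hk
    rw [map_smul, coeff_powerSum_mul_homogeneousComponent (by omega), smul_eq_mul, mul_ite,
      mul_zero, show k + (n - k) = n by omega]
  rw [Finset.sum_congr rfl h1]
  split_ifs with hd
  · subst hd
    exact degree_mul_coeff_mulSeries hg hb d
  · simp

/-- Newton's identity determines the component of degree `n > 0` from the lower ones, after division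
by `n`. The recursions for `g` and `h` differ by the signs `(-1)^(k-1)` with which `ω` acts on
`p_k`. -/
theorem mulSeries_mem_omegaSpan {g h b : ℕ → ℚ} (hg : g 0 = 1) (hh : h 0 = 1)
    (hgb : ∀ n, n * g n = ∑ k ∈ Finset.Icc 1 n, b k * g (n - k))
    (hhb : ∀ n, n * h n = ∑ k ∈ Finset.Icc 1 n, (-1) ^ (k - 1) * b k * h (n - k)) (n : ℕ) :
    (homogeneousComponent n (mulSeries g), homogeneousComponent n (mulSeries h)) ∈
      omegaSpan n := by
  induction n using Nat.strong_induction_on with | _ n ih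
  rcases eq_or_ne n 0 with rfl | hn
  · have h0 : ∀ g : ℕ → ℚ, homogeneousComponent 0 (mulSeries g) = 1 := by
      classical
      intro g
      ext d
      rw [coeff_homogeneousComponent, coeff_one]
      simp only [Finsupp.degree_eq_zero_iff]
      split_ifs with hd
      · simp [hd, coeff_mulSeries]
      · rfl
    rw [h0, h0]
    refine Submodule.subset_span ⟨Nat.Partition.indiscrete 0, ?_⟩
    simp [multiplicative]
  · have h1 : (n : ℚ) • ((homogeneousComponent n (mulSeries g),
        homogeneousComponent n (mulSeries h)) : MvPowerSeries ℕ ℚ × MvPowerSeries ℕ ℚ) =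
        ∑ k ∈ Finset.Icc 1 n, b k • (powerSum k * homogeneousComponent (n - k) (mulSeries g),
          ((-1 : ℚ) ^ (k - 1)) • (powerSum k * homogeneousComponent (n - k) (mulSeries h))) := by
      rw [Prod.smul_mk, smul_homogeneousComponent_mulSeries hg hgb,
        smul_homogeneousComponent_mulSeries hh hhb]
      ext1
      · simp [Prod.fst_sum]
      · simp [Prod.snd_sum, smul_smul, mul_comm]
    have hn' : (n : ℚ) ≠ 0 := by exact_mod_cast hn
    rw [← inv_smul_smul₀ hn' (_, _), h1]
    refine Submodule.smul_mem _ _ (Submodule.sum_mem _ fun k hk => Submodule.smul_mem _ _ ?_)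
    rw [Finset.mem_Icc] at hk
    have := mul_powerSum_mem_omegaSpan (k := k) (by omega) (ih (n - k) (by omega))
    rwa [show k + (n - k) = n by omega] at this

/-- If `h(t) g(-t) = 1`, then `ω` sends `∏ i, g (X i)` to `∏ i, h (X i)`. -/
theorem mulSeries_mem_omegaSpan_of_inverse {g h : ℕ → ℚ} (hg : g 0 = 1) (hh : h 0 = 1)
    (hgh : ∀ n ≠ 0, ∑ p ∈ Finset.HasAntidiagonal.antidiagonal n,
      (-1) ^ p.1 * g p.1 * h p.2 = 0) (n : ℕ) :
    (homogeneousComponent n (mulSeries g), homogeneousComponent n (mulSeries h)) ∈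
      omegaSpan n := by
  let N := PowerSeries.rescale (-1 : ℚ)
  let θ : PowerSeries ℚ → PowerSeries ℚ := fun f => PowerSeries.X * PowerSeries.derivative ℚ f
  let A : PowerSeries ℚ := PowerSeries.mk g
  let B : PowerSeries ℚ := PowerSeries.mk h
  have hθ : ∀ f n, PowerSeries.coeff n (θ f) = n * PowerSeries.coeff n f := by
    intro f n
    cases n with
    | zero => simp [θ]
    | succ n => simp [θ, PowerSeries.coeff_succ_X_mul, PowerSeries.coeff_derivative, mul_comm]
  have hNθ : ∀ f, θ (N f) = N (θ f) := by
    intro f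
    ext n
    simp only [N, hθ, PowerSeries.coeff_rescale]
    ring
  have hAB : N A * B = 1 := by
    ext n
    rw [PowerSeries.coeff_mul, PowerSeries.coeff_one]
    simp only [N, A, B, PowerSeries.coeff_rescale, PowerSeries.coeff_mk]
    split_ifs with hn
    · subst hn
      simp [hg, hh]
    · exact hgh n hn
  have hA0 : PowerSeries.constantCoeff A ≠ 0 := by
    simp [A, hg]
  -- `θ` is `t d/dt` and `N` substitutes `-t`, so `C` is the logarithmic derivative `t A' / A`.
  let C : PowerSeries ℚ := A⁻¹ * θ A
  have hC : A * C = θ A := by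
    rw [← mul_assoc, PowerSeries.mul_inv_cancel A hA0, one_mul]
  have hC0 : PowerSeries.coeff 0 C = 0 := by
    simp [C, θ]
  -- Applying `θ` to `A(-t) B(t) = 1` gives `t B' / B = -C(-t)`, whose coefficients are `(-1)^(k-1)`
  -- times those of `C`.
  have hB : θ B = - (N C * B) := by
    have h1 : θ (N A * B) = N A * θ B + B * θ (N A) := by
      simp only [θ, Derivation.leibniz, smul_eq_mul]
      ring
    have h2 : θ 1 = 0 := by simp [θ]
    rw [hAB, h2, hNθ, ← hC, map_mul] at h1
    linear_combination (-B) * h1 + (- θ B - B * N C) * hAB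
  have hsum : ∀ (P Q : PowerSeries ℚ), PowerSeries.coeff 0 P = 0 → ∀ n,
      PowerSeries.coeff n (P * Q) = ∑ k ∈ Finset.Icc 1 n,
        PowerSeries.coeff k P * PowerSeries.coeff (n - k) Q := by
    intro P Q hP n
    rw [PowerSeries.coeff_mul, Finset.Nat.sum_antidiagonal_eq_sum_range_succ_mk]
    refine (Finset.sum_subset (fun k hk => ?_) fun k hk hk' => ?_).symm
    · simp only [Finset.mem_Icc, Finset.mem_range] at *
      omega
    · have : k = 0 := by
        simp only [Finset.mem_Icc, Finset.mem_range] at *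
        omega
      rw [this, hP, zero_mul]
  refine mulSeries_mem_omegaSpan (b := fun k => PowerSeries.coeff k C) hg hh ?_ ?_ n
  · intro n
    have := congrArg (PowerSeries.coeff n) hC
    rw [mul_comm, hsum C A hC0, hθ] at this
    simpa [A] using this.symm
  · intro n
    have := congrArg (PowerSeries.coeff n) hB
    rw [hθ, ← neg_mul, hsum _ _ (by
      rw [map_neg, PowerSeries.coeff_rescale, hC0, mul_zero, neg_zero])] at this
    simp only [B, PowerSeries.coeff_mk] at this
    rw [this]
    refine Finset.sum_congr rfl fun k hk => ?_
    rw [Finset.mem_Icc] at hk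
    obtain ⟨j, rfl⟩ : ∃ j, k = j + 1 := ⟨k - 1, by omega⟩
    simp only [N, map_neg, PowerSeries.coeff_rescale, pow_succ, Nat.add_sub_cancel]
    ring

theorem IsOmega.eq {f g g' : MvPowerSeries ℕ ℚ} (h : IsOmega f g) (h' : IsOmega f g') :
    g = g' := by
  obtain ⟨a, ha, hg⟩ := h
  obtain ⟨a', ha', hg'⟩ := h'
  obtain rfl := powerSumLike_powerSum.hasExpansion_unique ha ha'
  exact hg.unique hg'

end Omega

/-! ### Covering families -/

section Covering

open MvPowerSeries

variable {V : Type*} [Fintype V]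

open Classical in
/-- Families of objects, one for each variable of the monomial `d`, of sizes given by its
exponents. -/
noncomputable def families {α : Type*} (T : ℕ → Finset α) (d : ℕ →₀ ℕ) :
    Finset (d.support → α) :=
  Fintype.piFinset fun i => T (d i)

theorem mem_families {α : Type*} {T : ℕ → Finset α} {d : ℕ →₀ ℕ} {f : d.support → α} :
    f ∈ families T d ↔ ∀ i : d.support, f i ∈ T (d i) :=
  Fintype.mem_piFinset

open Classical in
theorem card_filter_covering {α : Type*} (s : Finset α) (σ : α → Finset V) :
    ((s.filter fun x => ∀ v, v ∈ σ x).card : ℚ) =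
      ∑ W : Finset V, (-1) ^ Wᶜ.card * ((s.filter (σ · ⊆ W)).card : ℚ) := by
  simp_rw [Finset.card_filter, Nat.cast_sum, Finset.mul_sum]
  rw [Finset.sum_comm]
  refine Finset.sum_congr rfl fun x _ => ?_
  have h1 : ∑ W : Finset V, (-1 : ℚ) ^ Wᶜ.card * ((if σ x ⊆ W then 1 else 0 : ℕ) : ℚ) =
      ∑ W : Finset V, (-1 : ℚ) ^ W.card * ((if σ x ⊆ Wᶜ then 1 else 0 : ℕ) : ℚ) := by
    refine Finset.sum_nbij' compl compl ?_ ?_ ?_ ?_ ?_ <;> simp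
  have h2 : ∑ W : Finset V, (-1 : ℚ) ^ W.card * ((if σ x ⊆ Wᶜ then 1 else 0 : ℕ) : ℚ) =
      ∑ W ∈ (σ x)ᶜ.powerset, (-1 : ℚ) ^ W.card := by
    simp_rw [Nat.cast_ite, Nat.cast_one, Nat.cast_zero, mul_ite, mul_one, mul_zero]
    rw [← Finset.sum_filter]
    refine Finset.sum_congr (Finset.ext fun W => ?_) fun _ _ => rfl
    simpa using le_compl_comm
  rw [h1, h2]
  have h3 := congrArg (Int.cast : ℤ → ℚ) (Finset.sum_powerset_neg_one_pow_card (x := (σ x)ᶜ))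
  push_cast at h3
  rw [h3]
  simp [Finset.eq_univ_iff_forall]

open Classical in
-- Confining all members of a family to `W` makes the choices for different variables independent,
-- so each term of the inclusion-exclusion is a coefficient of a product series.
theorem card_covering_families {α : Type*} {T : ℕ → Finset α} (σ : α → Finset V) (d : ℕ →₀ ℕ) :
    (((families T d).filter fun f => ∀ v, ∃ i, v ∈ σ (f i)).card : ℚ) =
      ∑ W : Finset V, (-1) ^ Wᶜ.card *
        coeff d (mulSeries fun n => (((T n).filter (σ · ⊆ W)).card : ℚ)) := by
  have h := card_filter_covering (families T d)
    (fun f => Finset.univ.biUnion fun i => σ (f i))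
  simp only [Finset.mem_biUnion, Finset.mem_univ, true_and] at h
  rw [h]
  refine Finset.sum_congr rfl fun W _ => ?_
  congr 1
  have h2 : (families T d).filter (fun f => (Finset.univ.biUnion fun i => σ (f i)) ⊆ W) =
      Fintype.piFinset fun i : d.support => (T (d i)).filter (σ · ⊆ W) := by
    ext f
    simp only [Finset.mem_filter, mem_families, Fintype.mem_piFinset, Finset.biUnion_subset,
      Finset.mem_univ, forall_const, forall_and]
  rw [h2, Fintype.card_piFinset, coeff_mulSeries, Nat.cast_prod,
    Finset.prod_coe_sort d.support fun i => (((T (d i)).filter (σ · ⊆ W)).card : ℚ)]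

end Covering

/-! ### The Kromatic symmetric function and its image under the involution -/

section Kromatic

open MvPowerSeries

variable {V : Type*} [Fintype V]

theorem monomial_setColoring (κ : V → Finset ℕ) :
    ∏ v : V, ∏ i ∈ κ v, (X i : MvPowerSeries ℕ ℚ) =
      monomial (∑ v : V, ∑ i ∈ κ v, Finsupp.single i 1) 1 := by
  have h : ∏ v : V, ∏ i ∈ κ v, (MvPolynomial.X i : MvPolynomial ℕ ℚ)
      = MvPolynomial.monomial (∑ v : V, ∑ i ∈ κ v, Finsupp.single i 1) 1 := by
    simp_rw [MvPolynomial.monomial_sum_one]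
    rfl
  have h2 := congrArg (MvPolynomial.coeToMvPowerSeries.ringHom (R := ℚ) (σ := ℕ)) h
  simpa [map_prod] using h2

open Classical in
theorem sum_single_setColoring_apply (κ : V → Finset ℕ) (i : ℕ) :
    (∑ v : V, ∑ i ∈ κ v, Finsupp.single i 1 : ℕ →₀ ℕ) i =
      (Finset.univ.filter fun v => i ∈ κ v).card := by
  rw [Finsupp.finsetSum_apply, Finset.card_filter]
  refine Finset.sum_congr rfl fun v _ => ?_
  rw [Finsupp.finsetSum_apply]
  simp [Finsupp.single_apply]

open Classical in
/-- The coloring for which color `i` is used on the set `f i`. -/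
noncomputable def coloringOf {d : ℕ →₀ ℕ} (f : d.support → Finset V) (v : V) : Finset ℕ :=
  (Finset.univ.filter fun i => v ∈ f i).map (Function.Embedding.subtype _)

omit [Fintype V] in
theorem mem_coloringOf {d : ℕ →₀ ℕ} {f : d.support → Finset V} {v : V} {i : ℕ} :
    i ∈ coloringOf f v ↔ ∃ h : i ∈ d.support, v ∈ f ⟨i, h⟩ := by
  simp [coloringOf]

open Classical in
-- A set coloring is the same as its family of color classes: disjointness on edges makes them
-- stable, nonemptiness makes them cover `V`, and the exponent of `x_i` is the size of class `i`.
theorem coeff_kromatic (G : SimpleGraph V) (d : ℕ →₀ ℕ) : coeff d (kromatic G) =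
    ((families (stableFinset G) d).filter fun f => ∀ v, ∃ i, v ∈ f i).card := by
  have h := (summable_kromatic G).hasSum
  rw [WithPiTopology.hasSum_iff_hasSum_coeff] at h
  refine (h d).unique ?_
  simp_rw [monomial_setColoring, coeff_monomial]
  let 𝓕 := (families (stableFinset G) d).filter fun f => ∀ v, ∃ i, v ∈ f i
  have hprop : ∀ f ∈ 𝓕, IsProperSetColoring G (coloringOf f) := by
    intro f hf
    simp only [𝓕, Finset.mem_filter, mem_families, mem_stableFinset] at hf
    refine ⟨fun v => ?_, fun u v huv => ?_⟩
    · obtain ⟨i, hi⟩ := hf.2 v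
      exact ⟨i, mem_coloringOf.2 ⟨i.2, hi⟩⟩
    · rw [Finset.disjoint_left]
      intro i hu hv
      obtain ⟨hi, hu⟩ := mem_coloringOf.1 hu
      obtain ⟨_, hv⟩ := mem_coloringOf.1 hv
      exact (hf.1 ⟨i, hi⟩).2 u hu v hv huv
  let ψ : 𝓕 → {κ : V → Finset ℕ // IsProperSetColoring G κ} :=
    fun f => ⟨coloringOf f.1, hprop f.1 f.2⟩
  have hψ : Function.Injective ψ := by
    intro f g hfg
    ext i v
    have := congrFun (congrArg Subtype.val hfg) v
    have := congrArg (i.1 ∈ ·) this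
    simpa [ψ, mem_coloringOf] using this
  have hexp : ∀ f ∈ 𝓕, d = ∑ v : V, ∑ i ∈ coloringOf f v, Finsupp.single i 1 := by
    intro f hf
    simp only [𝓕, Finset.mem_filter, mem_families, mem_stableFinset] at hf
    ext i
    rw [sum_single_setColoring_apply]
    simp_rw [mem_coloringOf]
    by_cases hi : i ∈ d.support
    · rw [← (hf.1 ⟨i, hi⟩).1]
      congr 1
      ext v
      simp [hi]
    · simp [hi, Finsupp.notMem_support_iff.1 hi]
  rw [← hψ.hasSum_iff]
  · have : ((fun κ : {κ : V → Finset ℕ // IsProperSetColoring G κ} =>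
        if d = ∑ v : V, ∑ i ∈ κ.1 v, Finsupp.single i 1 then (1 : ℚ) else 0) ∘ ψ) =
        fun _ => 1 := by
      funext f
      exact if_pos (hexp f.1 f.2)
    rw [this]
    have h1 := hasSum_fintype (fun _ : 𝓕 => (1 : ℚ))
    simp only [Finset.sum_const, Finset.card_univ, Fintype.card_coe, nsmul_eq_mul, mul_one] at h1
    exact h1
  · rintro ⟨κ, hκ⟩ hrange
    refine if_neg fun hd => hrange ?_
    have hdi : ∀ i, d i = (Finset.univ.filter fun v => i ∈ κ v).card := fun i => by
      conv_lhs => rw [hd]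
      exact sum_single_setColoring_apply κ i
    have hmem : ∀ v, ∀ i ∈ κ v, i ∈ d.support := by
      intro v i hi
      rw [Finsupp.mem_support_iff, hdi, Finset.card_ne_zero]
      exact ⟨v, by simpa using hi⟩
    refine ⟨⟨fun i => Finset.univ.filter fun v => i.1 ∈ κ v, ?_⟩, ?_⟩
    · simp only [𝓕, Finset.mem_filter, mem_families, mem_stableFinset, Finset.mem_univ, true_and]
      refine ⟨fun i => ⟨(hdi i).symm, fun u hu v hv huv => ?_⟩, fun v => ?_⟩
      · exact Finset.disjoint_left.1 (hκ.2 u v huv) hu hv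
      · obtain ⟨i, hi⟩ := hκ.1 v
        exact ⟨⟨i, hmem v i hi⟩, hi⟩
    · refine Subtype.ext (funext fun v => Finset.ext fun i => ?_)
      simp only [ψ, mem_coloringOf, Finset.mem_filter, Finset.mem_univ, true_and, exists_prop]
      exact ⟨fun h => h.2, fun h => ⟨hmem v i h, h⟩⟩

open Classical in
/-- The image of the Kromatic symmetric function under the involution. -/
noncomputable def omegaKromatic (G : SimpleGraph V) : MvPowerSeries ℕ ℚ :=
  ∑ W : Finset V, ((-1 : ℚ) ^ Wᶜ.card) •
    mulSeries fun n => (((heapFinset G n).filter (·.supp ⊆ W)).card : ℚ)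

open Classical in
theorem kromatic_eq_sum (G : SimpleGraph V) : kromatic G =
    ∑ W : Finset V, ((-1 : ℚ) ^ Wᶜ.card) •
      mulSeries fun n => (((stableFinset G n).filter (· ⊆ W)).card : ℚ) := by
  ext d
  rw [coeff_kromatic, map_sum]
  simp only [map_smul, smul_eq_mul]
  exact card_covering_families (T := stableFinset G) (fun S => S) d

open Classical in
theorem coeff_omegaKromatic (G : SimpleGraph V) (d : ℕ →₀ ℕ) : coeff d (omegaKromatic G) =
    ((families (heapFinset G) d).filter fun f => ∀ v, ∃ i, v ∈ (f i).supp).card := by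
  rw [card_covering_families, omegaKromatic, map_sum]
  simp only [map_smul, smul_eq_mul]

theorem isOmega_kromatic (G : SimpleGraph V) : IsOmega (kromatic G) (omegaKromatic G) := by
  classical
  refine isOmega_of_mem_omegaSpan fun n => ?_
  have hpair : (homogeneousComponent n (kromatic G), homogeneousComponent n (omegaKromatic G)) =
      ∑ W : Finset V, ((-1 : ℚ) ^ Wᶜ.card) •
        (homogeneousComponent n
            (mulSeries fun n => (((stableFinset G n).filter (· ⊆ W)).card : ℚ)),
          homogeneousComponent n
            (mulSeries fun n => (((heapFinset G n).filter (·.supp ⊆ W)).card : ℚ))) := by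
    rw [kromatic_eq_sum, omegaKromatic, map_sum, map_sum]
    ext1
    · simp [Prod.fst_sum]
    · simp [Prod.snd_sum]
  rw [hpair]
  refine Submodule.sum_mem _ fun W _ => ?_
  refine Submodule.smul_mem _ _ (mulSeries_mem_omegaSpan_of_inverse ?_ ?_ ?_ n)
  · have : (stableFinset G 0).filter (· ⊆ W) = {∅} := by
      ext S
      simp only [Finset.mem_filter, mem_stableFinset, Finset.card_eq_zero, Finset.mem_singleton]
      refine ⟨fun h => h.1.1, ?_⟩
      rintro rfl
      simp
    rw [this]
    simp
  · have : (heapFinset G 0).filter (·.supp ⊆ W) = {1} := by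
      ext H
      simp only [Finset.mem_filter, mem_heapFinset, Finset.mem_singleton, Heap.size_eq_zero_iff]
      refine ⟨fun h => h.1, ?_⟩
      rintro rfl
      simp [Heap.supp]
    rw [this]
    simp
  · intro m hm
    exact_mod_cast congrArg (Int.cast : ℤ → ℚ) (sum_antidiagonal_stable_heap (G := G) W hm)

end Kromatic

/-! ### The expansion in the basis of the `p̄'` -/

section Expansion

open MvPowerSeries

variable {V : Type*} [Fintype V] [LinearOrder V] {G : SimpleGraph V}

open Classical in
/-- The set of the Lyndon factors that occur in a family of heaps. -/
noncomputable def familyFactors {d : ℕ →₀ ℕ} (f : d.support → Heap G) : Finset (Heap G) :=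
  Finset.univ.biUnion fun i => (f i).lyndonFactors.toFinset

omit [Fintype V] in
theorem mem_familyFactors {d : ℕ →₀ ℕ} {f : d.support → Heap G} {L : Heap G} :
    L ∈ familyFactors f ↔ ∃ i, L ∈ (f i).lyndonFactors := by
  simp [familyFactors]

open Classical in
/-- The exponents with which the Lyndon heap `L` contributes to a family of heaps. -/
noncomputable def factorExponents {d : ℕ →₀ ℕ} (f : d.support → Heap G) (L : Heap G) :
    ℕ →₀ ℕ :=
  Finsupp.onFinset d.support
    (fun i => if h : i ∈ d.support then L.size * (f ⟨i, h⟩).lyndonFactors.count L else 0)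
    fun i hi => by
      by_contra h
      exact hi (dif_neg h)

open Classical in
omit [Fintype V] in
theorem factorExponents_apply {d : ℕ →₀ ℕ} (f : d.support → Heap G) (L : Heap G)
    (i : d.support) :
    factorExponents f L i = L.size * (f i).lyndonFactors.count L := by
  simp only [factorExponents, Finsupp.onFinset_apply]
  rw [dif_pos i.2]

omit [Fintype V] in
theorem factorExponents_apply_of_notMem {d : ℕ →₀ ℕ} (f : d.support → Heap G) (L : Heap G)
    {i : ℕ} (hi : i ∉ d.support) : factorExponents f L i = 0 := by
  simp only [factorExponents, Finsupp.onFinset_apply]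
  rw [dif_neg hi]

omit [Fintype V] in
theorem factorExponents_eq_zero_iff {d : ℕ →₀ ℕ} {f : d.support → Heap G} {L : Heap G}
    (hL : L.IsLyndon) : factorExponents f L = 0 ↔ L ∉ familyFactors f := by
  classical
  rw [mem_familyFactors, not_exists]
  refine ⟨fun h i hi => ?_, fun h => Finsupp.ext fun i => ?_⟩
  · have h1 := factorExponents_apply f L i
    rw [h, Finsupp.zero_apply, eq_comm, mul_eq_zero, Multiset.count_eq_zero] at h1
    exact h1.elim hL.size_pos.ne' (fun h2 => h2 hi)
  · by_cases hi : i ∈ d.support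
    · have := factorExponents_apply f L ⟨i, hi⟩
      rw [Multiset.count_eq_zero_of_notMem (h _), mul_zero] at this
      exact this
    · exact factorExponents_apply_of_notMem f L hi

omit [Fintype V] in
theorem Heap.sum_size_mul_count {H : Heap G} {S : Finset (Heap G)} [DecidableEq (Heap G)]
    (hS : ∀ L ∈ H.lyndonFactors, L ∈ S) :
    ∑ L ∈ S, L.size * H.lyndonFactors.count L = H.size := by
  rw [H.size_eq_sum, Finset.sum_multiset_map_count]
  simp_rw [smul_eq_mul, mul_comm]
  refine (Finset.sum_subset (fun L hL => hS L (Multiset.mem_toFinset.1 hL)) fun L _ hL => ?_).symm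
  rw [Multiset.mem_toFinset] at hL
  rw [Multiset.count_eq_zero_of_notMem hL, zero_mul]

omit [Fintype V] in
theorem exists_heap_count_eq [DecidableEq (Heap G)] {S : Finset (Heap G)}
    (hS : ∀ L ∈ S, L.IsLyndon) (c : Heap G → ℕ) :
    ∃ H : Heap G, ∀ L, H.lyndonFactors.count L = if L ∈ S then c L else 0 := by
  have hc : ∀ L, (∑ M ∈ S, Multiset.replicate (c M) M).count L = if L ∈ S then c L else 0 := by
    intro L
    rw [Multiset.count_sum']
    simp_rw [Multiset.count_replicate]
    simp
  obtain ⟨H, hH⟩ := Heap.exists_lyndonFactors_eq (∑ M ∈ S, Multiset.replicate (c M) M) (by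
    intro L hL
    have := hc L
    by_contra h
    rw [if_neg fun hLS => h (hS L hLS), Multiset.count_eq_zero] at this
    exact this hL)
  exact ⟨H, fun L => by rw [hH, hc]⟩

open Classical in
/-- The coefficients of `∏ L ∈ S, p̄'_{|L|}` count families of heaps with set of factors `S`. -/
theorem coeff_prod_pbar' {S : Finset (Heap G)} (hS : ∀ L ∈ S, L.IsLyndon) (d : ℕ →₀ ℕ) :
    coeff d (∏ L ∈ S, pbar' L.size) =
      ((families (heapFinset G) d).filter fun f => familyFactors f = S).card := by
  have h1 : ∀ l ∈ S.finsuppAntidiag d, ∏ L ∈ S, coeff (l L) (pbar' L.size) =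
      if ∀ L ∈ S, l L ≠ 0 ∧ ∀ i, L.size ∣ l L i then 1 else 0 := by
    intro l _
    split_ifs with h
    · refine Finset.prod_eq_one fun L hL => ?_
      rw [coeff_pbar' (hS L hL).size_pos.ne', if_pos (h L hL)]
    · push Not at h
      obtain ⟨L, hL, h⟩ := h
      refine Finset.prod_eq_zero hL ?_
      rw [coeff_pbar' (hS L hL).size_pos.ne', if_neg]
      exact fun h' => (h h'.1).elim fun i hi => hi (h'.2 i)
  rw [coeff_prod, Finset.sum_congr rfl h1, ← Finset.sum_filter, Finset.sum_const, nsmul_eq_mul,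
    mul_one, Nat.cast_inj]
  symm
  have hout : ∀ f : d.support → Heap G, familyFactors f = S → ∀ L, L ∉ S →
      ∀ i, L ∉ (f i).lyndonFactors := by
    rintro f rfl L hL i hi
    exact hL (mem_familyFactors.2 ⟨i, hi⟩)
  refine Finset.card_bij (fun f _ => Finsupp.onFinset S
    (fun L => if L ∈ S then factorExponents f L else 0) fun L hL => ?_) ?_ ?_ ?_
  · by_contra h
    exact hL (if_neg h)
  · intro f hf
    simp only [Finset.mem_filter, mem_families, mem_heapFinset] at hf
    rw [Finset.mem_filter, Finset.mem_finsuppAntidiag]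
    simp only [Finsupp.onFinset_apply]
    refine ⟨⟨?_, Finsupp.support_onFinset_subset⟩, fun L hL => ?_⟩
    · refine (Finset.sum_congr rfl fun L hL => if_pos hL).trans ?_
      ext i
      rw [Finsupp.finsetSum_apply]
      by_cases hi : i ∈ d.support
      · simp_rw [fun L => factorExponents_apply f L ⟨i, hi⟩]
        rw [Heap.sum_size_mul_count, hf.1 ⟨i, hi⟩]
        intro L hL
        by_contra hLS
        exact hout f hf.2 L hLS _ hL
      · simp_rw [factorExponents_apply_of_notMem f _ hi]
        simp [Finsupp.notMem_support_iff.1 hi]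
    · rw [if_pos hL]
      refine ⟨fun h => ?_, fun i => ?_⟩
      · rw [factorExponents_eq_zero_iff (hS L hL), hf.2] at h
        exact h hL
      · by_cases hi : i ∈ d.support
        · rw [factorExponents_apply f L ⟨i, hi⟩]
          exact dvd_mul_right _ _
        · rw [factorExponents_apply_of_notMem f L hi]
          exact dvd_zero _
  · intro f hf g hg hfg
    simp only [Finset.mem_filter] at hf hg
    funext i
    refine Heap.lyndonFactors_injective (Multiset.ext.2 fun L => ?_)
    by_cases hL : L ∈ S
    · have h2 := DFunLike.congr_fun (DFunLike.congr_fun hfg L) i.1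
      simp only [Finsupp.onFinset_apply, if_pos hL, factorExponents_apply] at h2
      exact Nat.eq_of_mul_eq_mul_left (hS L hL).size_pos h2
    · rw [Multiset.count_eq_zero_of_notMem (hout f hf.2 L hL i),
        Multiset.count_eq_zero_of_notMem (hout g hg.2 L hL i)]
  · intro l hl
    rw [Finset.mem_filter, Finset.mem_finsuppAntidiag] at hl
    obtain ⟨⟨hl1, hl2⟩, hl3⟩ := hl
    have hd : ∀ i, ∑ L ∈ S, l L i = d i := fun i => by
      rw [← hl1, Finsupp.finsetSum_apply]
    choose f hf using fun i : d.support => exists_heap_count_eq hS fun L => l L i / L.size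
    have hfS : ∀ i L, L ∈ (f i).lyndonFactors → L ∈ S := by
      intro i L hL
      rw [← Multiset.count_ne_zero, hf] at hL
      by_contra h
      exact hL (if_neg h)
    have hcount : ∀ (i : d.support) L, L ∈ S →
        L.size * (f i).lyndonFactors.count L = l L i := by
      intro i L hL
      rw [hf, if_pos hL, Nat.mul_div_cancel' ((hl3 L hL).2 i)]
    have hzero : ∀ L ∈ S, ∀ i ∉ d.support, l L i = 0 := by
      intro L hL i hi
      have := hd i
      rw [Finsupp.notMem_support_iff.1 hi, Finset.sum_eq_zero_iff] at this
      exact this L hL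
    have hexp : ∀ L ∈ S, factorExponents f L = l L := by
      intro L hL
      ext i
      by_cases hi : i ∈ d.support
      · rw [factorExponents_apply f L ⟨i, hi⟩, hcount _ L hL]
      · rw [factorExponents_apply_of_notMem f L hi, hzero L hL i hi]
    refine ⟨f, ?_, ?_⟩
    · simp only [Finset.mem_filter, mem_families, mem_heapFinset]
      refine ⟨fun i => ?_, Finset.ext fun L => ⟨fun hL => ?_, fun hL => ?_⟩⟩
      · rw [← Heap.sum_size_mul_count (hfS i), Finset.sum_congr rfl fun L hL => hcount i L hL, hd]
      · obtain ⟨i, hi⟩ := mem_familyFactors.1 hL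
        exact hfS i L hi
      · by_contra h
        rw [← factorExponents_eq_zero_iff (hS L hL), hexp L hL] at h
        exact (hl3 L hL).1 h
    · ext1 L
      rw [Finsupp.onFinset_apply]
      split_ifs with hL
      · exact hexp L hL
      · exact (Finsupp.notMem_support_iff.1 fun h => hL (hl2 h)).symm

/-- The covering sets of Lyndon heaps with prescribed sizes. -/
def lyndonSets (G : SimpleGraph V) (m : Multiset ℕ) : Set (Finset (Heap G)) :=
  {S | (∀ L ∈ S, L.IsLyndon) ∧ (∀ v : V, ∃ L ∈ S, v ∈ L.content) ∧ S.val.map Heap.size = m}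

theorem finite_lyndonSets (G : SimpleGraph V) (m : Multiset ℕ) : (lyndonSets G m).Finite := by
  classical
  refine (((Finset.range (m.sum + 1)).biUnion (heapFinset G)).powerset.finite_toSet).subset ?_
  rintro S ⟨-, -, hS⟩
  rw [Finset.mem_coe, Finset.mem_powerset]
  intro L hL
  rw [Finset.mem_biUnion]
  refine ⟨L.size, ?_, by simp⟩
  rw [Finset.mem_range, Nat.lt_succ_iff]
  refine Multiset.single_le_sum (fun _ _ => Nat.zero_le _) _ ?_
  rw [← hS]
  exact Multiset.mem_map_of_mem _ hL

/-- The heaps using every vertex with distinct Lyndon factors of prescribed sizes. -/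
def lyndonHeaps (G : SimpleGraph V) (m : Multiset ℕ) : Set (Heap G) :=
  {H | (∀ v : V, v ∈ H.content) ∧ ∃ f : List (Heap G), H.IsLyndonFactorization f ∧
    f.Nodup ∧ (f.map Heap.size : Multiset ℕ) = m}

omit [Fintype V] in
theorem mem_lyndonHeaps {m : Multiset ℕ} {H : Heap G} : H ∈ lyndonHeaps G m ↔
    (∀ v : V, v ∈ H.content) ∧ H.lyndonFactors.Nodup ∧ H.lyndonFactors.map Heap.size = m := by
  refine and_congr_right fun _ => ⟨?_, ?_⟩
  · rintro ⟨f, hf, h1, h2⟩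
    rw [← hf.coe_eq]
    exact ⟨h1, h2⟩
  · rintro ⟨h1, h2⟩
    obtain ⟨f, hf, he⟩ := H.exists_isLyndonFactorization
    rw [← he] at h1 h2
    exact ⟨f, hf, h1, h2⟩

open Classical in
omit [Fintype V] in
theorem injOn_toFinset_lyndonFactors (m : Multiset ℕ) :
    Set.InjOn (fun H : Heap G => H.lyndonFactors.toFinset) (lyndonHeaps G m) := by
  intro H hH K hK h
  rw [mem_lyndonHeaps] at hH hK
  refine Heap.lyndonFactors_injective ?_
  have := congrArg Finset.val h
  simpa only [Multiset.toFinset_val, hH.2.1.dedup, hK.2.1.dedup] using this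

open Classical in
omit [Fintype V] in
theorem image_lyndonHeaps (G : SimpleGraph V) (m : Multiset ℕ) :
    (fun H : Heap G => H.lyndonFactors.toFinset) '' lyndonHeaps G m = lyndonSets G m := by
  ext S
  constructor
  · rintro ⟨H, hH, rfl⟩
    rw [mem_lyndonHeaps] at hH
    refine ⟨fun L hL => Heap.isLyndon_of_mem_lyndonFactors (Multiset.mem_toFinset.1 hL),
      fun v => ?_, ?_⟩
    · obtain ⟨L, hL, hv⟩ := Heap.mem_content_iff.1 (hH.1 v)
      exact ⟨L, Multiset.mem_toFinset.2 hL, hv⟩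
    · rw [Multiset.toFinset_val, hH.2.1.dedup, hH.2.2]
  · rintro ⟨h1, h2, h3⟩
    obtain ⟨H, hH⟩ := Heap.exists_lyndonFactors_eq S.val h1
    refine ⟨H, mem_lyndonHeaps.2 ⟨fun v => ?_, hH ▸ S.nodup, hH ▸ h3⟩, ?_⟩
    · rw [Heap.mem_content_iff, hH]
      exact h2 v
    · simp [hH]

open Classical in
theorem ncard_mul_coeff_multiplicative (l : Ptn) (d : ℕ →₀ ℕ) :
    ((lyndonSets G l.2.parts).ncard : ℚ) * coeff d (multiplicative pbar' l) =
      (((families (heapFinset G) d).filter fun f => ∀ v, ∃ i, v ∈ (f i).supp).filter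
        fun f => (familyFactors f).val.map Heap.size = l.2.parts).card := by
  have hA := finite_lyndonSets G l.2.parts
  rw [Set.ncard_eq_toFinset_card _ hA, ← nsmul_eq_mul, ← Finset.sum_const]
  have h1 : ∀ S ∈ hA.toFinset, coeff d (multiplicative pbar' l) =
      (((families (heapFinset G) d).filter fun f => familyFactors f = S).card : ℚ) := by
    intro S hS
    rw [Set.Finite.mem_toFinset] at hS
    rw [← coeff_prod_pbar' hS.1, multiplicative, ← hS.2.2, Multiset.map_map]
    rfl
  rw [Finset.sum_congr rfl h1, ← Nat.cast_sum, Nat.cast_inj]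
  rw [Finset.card_eq_sum_card_fiberwise (f := familyFactors) (t := hA.toFinset)]
  · refine Finset.sum_congr rfl fun S hS => ?_
    rw [Set.Finite.mem_toFinset] at hS
    congr 1
    ext f
    simp only [Finset.mem_filter]
    refine ⟨?_, fun h => ⟨h.1.1.1, h.2⟩⟩
    rintro ⟨hf, rfl⟩
    refine ⟨⟨⟨hf, fun v => ?_⟩, hS.2.2⟩, rfl⟩
    obtain ⟨L, hL, hv⟩ := hS.2.1 v
    obtain ⟨i, hi⟩ := mem_familyFactors.1 hL
    exact ⟨i, Heap.mem_supp.2 (Heap.mem_content_iff.2 ⟨L, hi, hv⟩)⟩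
  · intro f hf
    simp only [Finset.coe_filter, Finset.mem_filter, Set.mem_ofPred_eq] at hf
    rw [Finset.mem_coe, Set.Finite.mem_toFinset]
    refine ⟨fun L hL => ?_, fun v => ?_, hf.2⟩
    · obtain ⟨i, hi⟩ := mem_familyFactors.1 hL
      exact Heap.isLyndon_of_mem_lyndonFactors hi
    · obtain ⟨i, hi⟩ := hf.1.2 v
      obtain ⟨L, hL, hv⟩ := Heap.mem_content_iff.1 (Heap.mem_supp.1 hi)
      exact ⟨L, mem_familyFactors.2 ⟨i, hL⟩, hv⟩

theorem hasExpansion_omegaKromatic (G : SimpleGraph V) :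
    HasExpansion (multiplicative pbar') (fun l => (lyndonSets G l.2.parts).ncard)
      (omegaKromatic G) := by
  classical
  rw [hasExpansion_iff]
  intro d
  simp_rw [ncard_mul_coeff_multiplicative]
  set 𝓗 := (families (heapFinset G) d).filter fun f => ∀ v, ∃ i, v ∈ (f i).supp
  have hF : coeff d (omegaKromatic G) = (𝓗.card : ℚ) := by
    rw [coeff_omegaKromatic]
    congr!
  let t : (d.support → Heap G) → Ptn := fun f =>
    ⟨_, Nat.Partition.ofMultiset ((familyFactors f).val.map Heap.size)⟩
  have ht : ∀ f (l : Ptn), (familyFactors f).val.map Heap.size = l.2.parts ↔ t f = l := by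
    intro f l
    have hparts : (t f).2.parts = (familyFactors f).val.map Heap.size := by
      simp only [t, Nat.Partition.ofMultiset, Nat.Partition.ofSums_parts]
      rw [Multiset.filter_eq_self]
      intro n hn
      obtain ⟨L, hL, rfl⟩ := Multiset.mem_map.1 hn
      obtain ⟨i, hi⟩ := mem_familyFactors.1 hL
      exact (Heap.isLyndon_of_mem_lyndonFactors hi).size_pos.ne'
    refine ⟨fun h => ?_, fun h => by rw [← h, hparts]⟩
    rw [← hparts] at h
    generalize t f = m at h
    obtain ⟨n, m⟩ := m
    obtain ⟨n', l⟩ := l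
    dsimp only at h
    obtain rfl : n = n' := by rw [← m.parts_sum, ← l.parts_sum, h]
    rw [Nat.Partition.ext h]
  simp_rw [ht]
  rw [hF, Finset.card_eq_sum_card_image t 𝓗, Nat.cast_sum]
  refine hasSum_sum_of_ne_finset_zero fun l hl => ?_
  rw [Nat.cast_eq_zero, Finset.card_eq_zero, Finset.filter_eq_empty_iff]
  rintro f hf rfl
  exact hl (Finset.mem_image_of_mem _ hf)

end Expansion

end KromaticHeaps

open KromaticHeaps in
/-- For a finite graph `G` with totally ordered vertex set, `ω(X̄_G)` is a well-defined series `F`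
with a unique expansion `∑ λ, c_λ p̄'_λ`, and `c_λ` is the number of sets of Lyndon heaps, and the
number of heaps, described in the statement. -/
theorem theorem1p5 {V : Type*} [Fintype V] [LinearOrder V] (G : SimpleGraph V) :
    (∀ H : Heap G, ∃! l : List (Heap G), H.IsLyndonFactorization l) ∧
    ∃ F : MvPowerSeries ℕ ℚ, (∀ F', IsOmega (kromatic G) F' ↔ F' = F) ∧
      ∃ c : Ptn → ℚ, (∀ c', HasExpansion (multiplicative pbar') c' F ↔ c' = c) ∧
        ∀ l : Ptn,
          (let A : Set (Finset (Heap G)) :=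
            {S | (∀ L ∈ S, L.IsLyndon) ∧ (∀ v : V, ∃ L ∈ S, v ∈ L.content) ∧
              S.val.map Heap.size = l.2.parts}
          A.Finite ∧ c l = A.ncard) ∧
          (let B : Set (Heap G) :=
            {H | (∀ v : V, v ∈ H.content) ∧ ∃ f : List (Heap G), H.IsLyndonFactorization f ∧
              f.Nodup ∧ (f.map Heap.size : Multiset ℕ) = l.2.parts}
          B.Finite ∧ c l = B.ncard) ∧
          0 ≤ c l := by
  classical
  refine ⟨Heap.existsUnique_isLyndonFactorization, omegaKromatic G, fun F' =>
    ⟨fun h => h.eq (isOmega_kromatic G), fun h => h ▸ isOmega_kromatic G⟩,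
    fun l => (lyndonSets G l.2.parts).ncard, fun c' =>
    ⟨fun h => powerSumLike_pbar'.hasExpansion_unique h (hasExpansion_omegaKromatic G),
      fun h => h ▸ hasExpansion_omegaKromatic G⟩, fun l =>
    ⟨⟨finite_lyndonSets G _, rfl⟩, ⟨?_, ?_⟩, Nat.cast_nonneg _⟩⟩
  · refine Set.Finite.of_finite_image ?_ (injOn_toFinset_lyndonFactors l.2.parts)
    exact (image_lyndonHeaps G l.2.parts).symm ▸ finite_lyndonSets G l.2.parts
  · have h := (injOn_toFinset_lyndonFactors (G := G) l.2.parts).ncard_image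
    rw [image_lyndonHeaps] at h
    exact congrArg Nat.cast h
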